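/- Let $n,k\ge 0$ be integers such that $m:=n+k$ is even, write $D:=-\mathrm{i}\,\frac{d}{dx}$, and let $a_\alpha$ ($0\le\alpha\le m$), $b_\beta$ ($0\le\beta\le n$), $c_\gamma$ ($0\le\gamma\le k$) and $d$ be functions in $C^\infty(\mathbb{R},\mathbb{C})$ with $a_m(x)\ne 0$ for all $x\in\mathbb{R}$. Put $\Delta:=d-\dfrac{b_nc_k}{a_m}$ and $\Omega:=\mathbb{C}\setminus\bigl(\mathrm{cl}\{\Delta(\mathbb{R})\}\cup\mathrm{cl}\{d(\mathbb{R})\}\bigr)$. For $\lambda\in\mathbb{C}\setminus\mathrm{cl}\{d(\mathbb{R})\}$ consider the differential expression $$\tau_S(\lambda)=\sum_{\alpha=0}^m a_\alpha D^\alpha-\lambda-\Bigl(\sum_{\beta=0}^n b_\beta D^\beta\Bigr)\frac1{d-\lambda}\Bigl(\sum_{\gamma=0}^k c_\gamma D^\gamma\Bigr)=\sum_{j=0}^m p_j(\cdot,\lambda)D^j,$$ where $p_j(\cdot,\lambda)$ are the coefficients obtained by expanding with the Leibniz rule. Let $B^\infty(\mathbb{R},\mathbb{C})$ be the space of $C^\infty$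 functions on $\mathbb{R}$ all of whose derivatives (including that of order $0$) are bounded. Assume that for every $\lambda\in\Omega$: 1. $p_j(\cdot,\lambda)\in B^\infty(\mathbb{R},\mathbb{C})$ for $0\le j\le m$; 2. there are constants $\theta_\lambda\in\mathbb{R}$ and $\delta_\lambda>0$ such that $\mathrm{Re}\bigl(e^{\mathrm{i}\theta_\lambda}p_m(x,\lambda)\bigr)\ge\delta_\lambda$ for all $x\in\mathbb{R}$; 3. $c_\gamma(d-\lambda)^{-1}\in B^\infty(\mathbb{R},\mathbb{C})$ for $0\le\gamma\le k$, and $\bigl(b_\beta(d-\lambda)^{-1}\bigr)^{(j)}\in B^\infty(\mathbb{R},\mathbb{C})$ for $0\le\beta\le n$ and $0\le j\le\beta$. Let $\lambda\in\Omega$ and let $S(\lambda)$ be the closure in $L^2(\mathbb{R})$ of the operator $S_0(\lambda)u:=\tau_S(\lambda)u$ whose domain is the Schwartz space $\mathscr{S}(\mathbb{R})$. Let $W(S(\lambda)):=\{\langle S(\lambda)u,u\rangle:\ u\in\mathrm{Dom}(S(\lambda)),\ \|u\|_{L^2(\mathbb{R})}=1\}$ be its numerical range and $\rho(S(\lambda))$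 its resolvent set. Then there are $z_0\in\mathbb{C}$, $\psi\in\mathbb{R}$ and $\vartheta\in[0,\frac{\pi}{2})$ such that $$\mathrm{cl}\{W(S(\lambda))\}\subset\bigl\{z_0+re^{\mathrm{i}(\psi+t)}:\ r\ge0,\ |t|\le\vartheta\bigr\},$$ that is, the closure of the numerical range is contained in a sector of semi-angle $\vartheta<\frac{\pi}{2}$. Moreover, $$\mathbb{C}\setminus\mathrm{cl}\{W(S(\lambda))\}\subset\rho(S(\lambda)).$$ -/

import Mathlib

open MeasureTheory
open scoped ContDiff SchwartzMap

noncomputable section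

/-! ### Differential expressions on the real line -/

/-- The power `D ^ j` of the momentum operator `D = -i d/dx`, applied to a function. -/
def momentumPow (j : ℕ) (u : ℝ → ℂ) : ℝ → ℂ :=
  fun x => (-Complex.I) ^ j * iteratedDeriv j u x

/-- The differential expression `∑_{j ≤ N} q_j D ^ j`, applied to a function. -/
def diffExpr (N : ℕ) (q : ℕ → ℝ → ℂ) (u : ℝ → ℂ) : ℝ → ℂ :=
  fun x => ∑ j ∈ Finset.range (N + 1), q j x * momentumPow j u x

/-- Smooth functions on the line all of whose derivatives (of order `0, 1, 2, …`) are bounded. -/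
def IsBInfty (f : ℝ → ℂ) : Prop :=
  ContDiff ℝ ∞ f ∧ ∀ j : ℕ, ∃ C : ℝ, ∀ x : ℝ, ‖iteratedDeriv j f x‖ ≤ C

/-- The coefficient functions of the operator matrix
`[∑_{α ≤ n+k} a_α D^α, ∑_{β ≤ n} b_β D^β; ∑_{γ ≤ k} c_γ D^γ, d]`. Only the values `a α` for
`α ≤ n + k`, `b β` for `β ≤ n` and `c γ` for `γ ≤ k` are ever used. -/
structure MatrixCoeffs where
  n : ℕ
  k : ℕ
  a : ℕ → ℝ → ℂ
  b : ℕ → ℝ → ℂ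
  c : ℕ → ℝ → ℂ
  d : ℝ → ℂ

namespace MatrixCoeffs

/-- The order `m = n + k` of the upper left entry. -/
def m (K : MatrixCoeffs) : ℕ := K.n + K.k

/-- Smoothness of all the coefficients, and `a_m` has no zero. -/
structure AssumptionA (K : MatrixCoeffs) : Prop where
  smooth_a : ∀ α ≤ K.m, ContDiff ℝ ∞ (K.a α)
  smooth_b : ∀ β ≤ K.n, ContDiff ℝ ∞ (K.b β)
  smooth_c : ∀ γ ≤ K.k, ContDiff ℝ ∞ (K.c γ)
  smooth_d : ContDiff ℝ ∞ K.d
  a_ne_zero : ∀ x, K.a K.m x ≠ 0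

/-- The function `Δ = d - b_n c_k / a_m`. -/
def Delta (K : MatrixCoeffs) : ℝ → ℂ :=
  fun x => K.d x - K.b K.n x * K.c K.k x / K.a K.m x

/-- The Schur complement expression
`τ_S(lam) = τ₁₁ - lam - τ₁₂ (τ₂₂ - lam)⁻¹ τ₂₁`, applied to a function. -/
def schurExpr (K : MatrixCoeffs) (lam : ℂ) (u : ℝ → ℂ) : ℝ → ℂ :=
  fun x => diffExpr K.m K.a u x - lam * u x
    - diffExpr K.n K.b (fun y => (K.d y - lam)⁻¹ * diffExpr K.k K.c u y) x

/-- The coefficient `p_j(·, lam)` of `D ^ j` in the standard form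
`τ_S(lam) = ∑_{j ≤ m} p_j(·, lam) D ^ j`, as given by the Leibniz rule
(see `schurExpr_eq_diffExpr` below). -/
def schurCoeff (K : MatrixCoeffs) (lam : ℂ) (j : ℕ) : ℝ → ℂ :=
  fun x => K.a j x - (if j = 0 then lam else 0)
    - ∑ β ∈ Finset.range (K.n + 1), ∑ γ ∈ Finset.range (K.k + 1),
        if γ ≤ j ∧ j ≤ β + γ then
          (β.choose (j - γ) : ℂ) * K.b β x *
            momentumPow (β + γ - j) (fun y => K.c γ y / (K.d y - lam)) x
        else 0

/-- The conditions on the coefficients under which the Schur complement is strongly elliptic,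
for every `lam` outside the closures of the ranges of `Δ` and `d`. The constants `θ` and `δ`
may depend on `lam`. The angle `θ` is an arbitrary real number. -/
structure AssumptionC (K : MatrixCoeffs) : Prop where
  schur_bounded : ∀ lam : ℂ,
    lam ∉ closure (Set.range K.Delta) ∪ closure (Set.range K.d) →
    ∀ j ≤ K.m, IsBInfty (K.schurCoeff lam j)
  strongly_elliptic : ∀ lam : ℂ,
    lam ∉ closure (Set.range K.Delta) ∪ closure (Set.range K.d) →
    ∃ θ : ℝ, ∃ δ > (0 : ℝ), ∀ x : ℝ,
      δ ≤ (Complex.exp (θ * Complex.I) * K.schurCoeff lam K.m x).re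
  c_bounded : ∀ lam : ℂ,
    lam ∉ closure (Set.range K.Delta) ∪ closure (Set.range K.d) →
    ∀ γ ≤ K.k, IsBInfty (fun x => K.c γ x * (K.d x - lam)⁻¹)
  b_bounded : ∀ lam : ℂ,
    lam ∉ closure (Set.range K.Delta) ∪ closure (Set.range K.d) →
    ∀ β ≤ K.n, ∀ j ≤ β, IsBInfty (iteratedDeriv j (fun x => K.b β x * (K.d x - lam)⁻¹))

end MatrixCoeffs

/-! ### The standard form of the Schur complement -/

lemma momentumPow_add (j : ℕ) {u v : ℝ → ℂ} (hu : ContDiff ℝ ∞ u) (hv : ContDiff ℝ ∞ v) (x : ℝ) :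
    momentumPow j (fun y => u y + v y) x = momentumPow j u x + momentumPow j v x := by
  unfold momentumPow
  rw [iteratedDeriv_fun_add ((hu.of_le (by exact_mod_cast le_top)).contDiffAt)
    ((hv.of_le (by exact_mod_cast le_top)).contDiffAt)]
  ring

lemma momentumPow_const_mul (j : ℕ) (r : ℂ) (u : ℝ → ℂ) (x : ℝ) :
    momentumPow j (fun y => r * u y) x = r * momentumPow j u x := by
  unfold momentumPow
  have h : iteratedDeriv j (fun y => r * u y) x = r * iteratedDeriv j u x :=
    iteratedDeriv_const_mul_field r u
  rw [h]
  ring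

lemma contDiff_momentumPow (j : ℕ) {u : ℝ → ℂ} (hu : ContDiff ℝ ∞ u) :
    ContDiff ℝ ∞ (momentumPow j u) := by
  unfold momentumPow
  refine contDiff_const.mul ?_
  rw [iteratedDeriv_eq_iterate]
  exact hu.iterate_deriv j

lemma momentumPow_momentumPow (i j : ℕ) (u : ℝ → ℂ) (x : ℝ) :
    momentumPow i (momentumPow j u) x = momentumPow (i + j) u x := by
  have h : momentumPow j u = fun y => (-Complex.I) ^ j * iteratedDeriv j u y := rfl
  rw [h, momentumPow_const_mul]
  unfold momentumPow
  rw [iteratedDeriv_eq_iterate, iteratedDeriv_eq_iterate, iteratedDeriv_eq_iterate,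
    ← Function.iterate_add_apply]
  ring

lemma momentumPow_sum (j N : ℕ) {f : ℕ → ℝ → ℂ} (hf : ∀ i < N, ContDiff ℝ ∞ (f i)) (x : ℝ) :
    momentumPow j (fun y => ∑ i ∈ Finset.range N, f i y) x
      = ∑ i ∈ Finset.range N, momentumPow j (f i) x := by
  induction N with
  | zero =>
    have := momentumPow_const_mul j 0 (fun _ => 0) x
    simpa using this
  | succ N ih =>
    simp only [Finset.sum_range_succ]
    rw [momentumPow_add j (ContDiff.sum fun i hi => hf i (by
      have := Finset.mem_range.1 hi; omega)) (hf N (by omega)),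
      ih fun i hi => hf i (by omega)]

/-- The Leibniz rule. -/
lemma momentumPow_mul (j : ℕ) {u v : ℝ → ℂ} (hu : ContDiff ℝ ∞ u) (hv : ContDiff ℝ ∞ v) (x : ℝ) :
    momentumPow j (fun y => u y * v y) x
      = ∑ i ∈ Finset.range (j + 1),
          (j.choose i : ℂ) * momentumPow (j - i) u x * momentumPow i v x := by
  unfold momentumPow
  rw [iteratedDeriv_fun_mul ((hu.of_le (by exact_mod_cast le_top)).contDiffAt)
    ((hv.of_le (by exact_mod_cast le_top)).contDiffAt), Finset.mul_sum,
    ← Finset.sum_range_reflect]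
  refine Finset.sum_congr rfl fun i hi => ?_
  have hi' : i ≤ j := by have := Finset.mem_range.1 hi; omega
  have e1 : j + 1 - 1 - i = j - i := by omega
  have e2 : j - (j - i) = i := by omega
  rw [e1, e2, Nat.choose_symm hi']
  have e3 : (-Complex.I) ^ j = (-Complex.I) ^ (j - i) * (-Complex.I) ^ i := by
    rw [← pow_add]; congr 1; omega
  rw [e3]
  ring

lemma contDiff_div_sub {K : MatrixCoeffs} (hA : K.AssumptionA) {lam : ℂ}
    (hd : lam ∉ closure (Set.range K.d)) {γ : ℕ} (hγ : γ ≤ K.k) :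
    ContDiff ℝ ∞ (fun y => K.c γ y / (K.d y - lam)) := by
  have h1 : ContDiff ℝ ∞ (fun y => K.d y - lam) := hA.smooth_d.sub contDiff_const
  have h2 : ∀ y, K.d y - lam ≠ 0 := fun y h =>
    hd (subset_closure ⟨y, by linear_combination h⟩)
  simp only [div_eq_mul_inv]
  exact (hA.smooth_c γ hγ).mul (h1.inv h2)

/-- For smooth `u`, the Schur complement expression has the standard form
`∑_{j ≤ m} p_j(·, lam) D ^ j u`. -/
theorem schurExpr_eq_diffExpr {K : MatrixCoeffs} (hA : K.AssumptionA) {lam : ℂ}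
    (hd : lam ∉ closure (Set.range K.d)) {u : ℝ → ℂ} (hu : ContDiff ℝ ∞ u) :
    K.schurExpr lam u = diffExpr K.m (K.schurCoeff lam) u := by
  funext x
  have key : diffExpr K.n K.b (fun y => (K.d y - lam)⁻¹ * diffExpr K.k K.c u y) x
      = ∑ β ∈ Finset.range (K.n + 1), ∑ γ ∈ Finset.range (K.k + 1),
          ∑ j ∈ Finset.range (K.m + 1), (if γ ≤ j ∧ j ≤ β + γ then
          (β.choose (j - γ) : ℂ) * K.b β x *
            momentumPow (β + γ - j) (fun y => K.c γ y / (K.d y - lam)) x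
          else 0) * momentumPow j u x := by
    rw [diffExpr]
    refine Finset.sum_congr rfl fun β hβ => ?_
    have hβ' : β ≤ K.n := by have := Finset.mem_range.1 hβ; omega
    have h1 : (fun y => (K.d y - lam)⁻¹ * diffExpr K.k K.c u y) = fun y =>
        ∑ γ ∈ Finset.range (K.k + 1), (K.c γ y / (K.d y - lam)) * momentumPow γ u y := by
      funext y
      rw [diffExpr, Finset.mul_sum]
      exact Finset.sum_congr rfl fun γ _ => by rw [div_eq_mul_inv]; ring
    rw [h1, momentumPow_sum β (K.k + 1) (f := fun γ y =>
      (K.c γ y / (K.d y - lam)) * momentumPow γ u y)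
      (fun γ hγ => (contDiff_div_sub hA hd (by omega)).mul (contDiff_momentumPow γ hu)),
      Finset.mul_sum]
    refine Finset.sum_congr rfl fun γ hγ => ?_
    have hγ' : γ ≤ K.k := by have := Finset.mem_range.1 hγ; omega
    rw [momentumPow_mul β (contDiff_div_sub hA hd hγ') (contDiff_momentumPow γ hu),
      Finset.mul_sum]
    simp only [ite_mul, zero_mul]
    rw [← Finset.sum_filter]
    refine Finset.sum_bij (fun i _ => i + γ) ?_ ?_ ?_ ?_
    · intro i hi
      have := Finset.mem_range.1 hi
      simp only [Finset.mem_filter, Finset.mem_range, MatrixCoeffs.m]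
      omega
    · intro i _ i' _ h
      omega
    · intro j hj
      simp only [Finset.mem_filter, Finset.mem_range] at hj
      exact ⟨j - γ, by simp only [Finset.mem_range]; omega, by omega⟩
    · intro i hi
      have := Finset.mem_range.1 hi
      have e1 : i + γ - γ = i := by omega
      have e2 : β + γ - (i + γ) = β - i := by omega
      rw [momentumPow_momentumPow, e1, e2]
      ring
  have key2 : ∑ j ∈ Finset.range (K.m + 1), (if j = 0 then lam else 0) * momentumPow j u x
      = lam * u x := by
    rw [Finset.sum_eq_single 0]
    · simp [momentumPow]
    · intro j _ hj
      simp [hj]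
    · simp
  rw [MatrixCoeffs.schurExpr, key, ← key2]
  simp only [diffExpr, MatrixCoeffs.schurCoeff, sub_mul, Finset.sum_sub_distrib, Finset.sum_mul]
  congr 1
  exact (Finset.sum_congr rfl fun β _ => Finset.sum_comm).trans Finset.sum_comm

/-! ### The Schur complement as a closed operator in `L²(ℝ)` -/

/-- The Hilbert space `L²(ℝ)`. -/
abbrev L2R : Type := Lp ℂ 2 (volume : Measure ℝ)

/-- The graph of the operator `φ ↦ τ_S(lam) φ` in `L²(ℝ)` defined on Schwartz functions. -/
def schurGraph (K : MatrixCoeffs) (hA : K.AssumptionA) (lam : ℂ)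
    (hd : lam ∉ closure (Set.range K.d)) : Submodule ℂ (L2R × L2R) where
  carrier := {p | ∃ φ : 𝓢(ℝ, ℂ), (p.1 : ℝ → ℂ) =ᵐ[volume] φ ∧
    (p.2 : ℝ → ℂ) =ᵐ[volume] K.schurExpr lam φ}
  zero_mem' := by
    refine ⟨0, Lp.coeFn_zero ℂ 2 volume, ?_⟩
    rw [schurExpr_eq_diffExpr hA hd (SchwartzMap.smooth _ ⊤)]
    refine (Lp.coeFn_zero ℂ 2 volume).trans (Filter.Eventually.of_forall fun x => ?_)
    have h (j : ℕ) : momentumPow j (⇑(0 : 𝓢(ℝ, ℂ))) x = 0 := by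
      have h' := momentumPow_const_mul j 0 (fun _ => 0) x
      simp only [zero_mul] at h'
      exact h'
    simp only [diffExpr, h, mul_zero, Finset.sum_const_zero, Pi.zero_apply]
  add_mem' := by
    rintro p q ⟨φ, h1, h2⟩ ⟨ψ, h3, h4⟩
    refine ⟨φ + ψ, ?_, ?_⟩
    · filter_upwards [Lp.coeFn_add p.1 q.1, h1, h3] with x hx hx1 hx3
      rw [Prod.fst_add, hx, Pi.add_apply, hx1, hx3, add_apply]
    · rw [schurExpr_eq_diffExpr hA hd (SchwartzMap.smooth _ ⊤)] at h2 h4 ⊢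
      filter_upwards [Lp.coeFn_add p.2 q.2, h2, h4] with x hx hx2 hx4
      have h (j : ℕ) : momentumPow j (⇑(φ + ψ)) x = momentumPow j φ x + momentumPow j ψ x :=
        momentumPow_add j (SchwartzMap.smooth _ ⊤) (SchwartzMap.smooth _ ⊤) x
      rw [Prod.snd_add, hx, Pi.add_apply, hx2, hx4]
      simp only [diffExpr, h, mul_add, Finset.sum_add_distrib]
  smul_mem' := by
    rintro r p ⟨φ, h1, h2⟩
    refine ⟨r • φ, ?_, ?_⟩
    · filter_upwards [Lp.coeFn_smul r p.1, h1] with x hx hx1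
      simp [hx, hx1]
    · rw [schurExpr_eq_diffExpr hA hd (SchwartzMap.smooth _ ⊤)] at h2 ⊢
      filter_upwards [Lp.coeFn_smul r p.2, h2] with x hx hx2
      have h (j : ℕ) : momentumPow j (⇑(r • φ)) x = r * momentumPow j φ x :=
        momentumPow_const_mul j r φ x
      simp only [diffExpr, h, Prod.smul_snd, hx, Pi.smul_apply, hx2, smul_eq_mul, Finset.mul_sum]
      exact Finset.sum_congr rfl fun j _ => by ring

/-- `schurGraph` is the graph of a function. -/
lemma schurGraph_snd_eq_zero (K : MatrixCoeffs) (hA : K.AssumptionA) (lam : ℂ)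
    (hd : lam ∉ closure (Set.range K.d)) (p : L2R × L2R) (hp : p ∈ schurGraph K hA lam hd)
    (h0 : p.1 = 0) : p.2 = 0 := by
  obtain ⟨φ, h1, h2⟩ := hp
  rw [h0] at h1
  have hφ : (φ : ℝ → ℂ) = fun _ => 0 :=
    (Continuous.ae_eq_iff_eq volume φ.continuous continuous_const).1
      (h1.symm.trans (Lp.coeFn_zero ℂ 2 volume))
  rw [schurExpr_eq_diffExpr hA hd (SchwartzMap.smooth _ ⊤)] at h2
  refine Lp.ext (h2.trans (Filter.EventuallyEq.trans (Filter.Eventually.of_forall fun x => ?_)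
    (Lp.coeFn_zero ℂ 2 volume).symm))
  have h (j : ℕ) : momentumPow j φ x = 0 := by
    rw [hφ]
    simpa using momentumPow_const_mul j 0 (fun _ => 0) x
  simp [diffExpr, h]

/-- The operator `S₀(lam)` in `L²(ℝ)`, acting as `φ ↦ τ_S(lam) φ` on Schwartz functions. -/
def schurOp₀ (K : MatrixCoeffs) (hA : K.AssumptionA) (lam : ℂ)
    (hd : lam ∉ closure (Set.range K.d)) : L2R →ₗ.[ℂ] L2R :=
  (schurGraph K hA lam hd).toLinearPMap

lemma mem_graph_schurOp₀ (K : MatrixCoeffs) (hA : K.AssumptionA) (lam : ℂ)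
    (hd : lam ∉ closure (Set.range K.d)) (p : L2R × L2R) :
    p ∈ (schurOp₀ K hA lam hd).graph ↔ ∃ φ : 𝓢(ℝ, ℂ), (p.1 : ℝ → ℂ) =ᵐ[volume] φ ∧
      (p.2 : ℝ → ℂ) =ᵐ[volume] K.schurExpr lam φ := by
  rw [schurOp₀, Submodule.toLinearPMap_graph_eq _ (schurGraph_snd_eq_zero K hA lam hd)]
  rfl

/-- If the coefficients `p_j(·, lam)` are bounded with all their derivatives, the domain of
`S₀(lam)` is the whole Schwartz space. -/
lemma mem_domain_schurOp₀ (K : MatrixCoeffs) (hA : K.AssumptionA) (lam : ℂ)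
    (hd : lam ∉ closure (Set.range K.d)) (hB : ∀ j ≤ K.m, IsBInfty (K.schurCoeff lam j))
    (f : L2R) :
    f ∈ (schurOp₀ K hA lam hd).domain ↔ ∃ φ : 𝓢(ℝ, ℂ), (f : ℝ → ℂ) =ᵐ[volume] φ := by
  rw [LinearPMap.mem_domain_iff]
  simp only [mem_graph_schurOp₀]
  refine ⟨fun ⟨_, φ, h, _⟩ => ⟨φ, h⟩, fun ⟨φ, h⟩ => ?_⟩
  have hmem : MemLp (K.schurExpr lam φ) 2 volume := by
    rw [schurExpr_eq_diffExpr hA hd (SchwartzMap.smooth _ ⊤)]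
    refine memLp_finsetSum _ fun j hj => ?_
    have hj' : j ≤ K.m := by have := Finset.mem_range.1 hj; omega
    obtain ⟨hs, hb⟩ := hB j hj'
    obtain ⟨C, hC⟩ := hb 0
    have hit (i : ℕ) : ∃ ψ : 𝓢(ℝ, ℂ), ⇑ψ = iteratedDeriv i φ := by
      induction i with
      | zero => exact ⟨φ, by simp⟩
      | succ i ih =>
        obtain ⟨ψ, hψ⟩ := ih
        exact ⟨SchwartzMap.derivCLM ℂ ℂ ψ, by
          funext x
          rw [SchwartzMap.derivCLM_apply, hψ, iteratedDeriv_succ]⟩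
    obtain ⟨ψ, hψ⟩ := hit j
    have hm : MemLp (momentumPow j φ) 2 volume := by
      unfold momentumPow
      rw [← hψ]
      exact (ψ.memLp 2 volume).const_mul _
    refine MemLp.of_le_mul (c := C) hm
      (hs.continuous.aestronglyMeasurable.mul hm.aestronglyMeasurable)
      (Filter.Eventually.of_forall fun x => ?_)
    rw [norm_mul]
    exact mul_le_mul_of_nonneg_right (by simpa using hC x) (norm_nonneg _)
  exact ⟨hmem.toLp _, φ, h, hmem.coeFn_toLp⟩

/-- The Schur complement `S(lam)`: the closure of `S₀(lam)`. -/
def schurOp (K : MatrixCoeffs) (hA : K.AssumptionA) (lam : ℂ)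
    (hd : lam ∉ closure (Set.range K.d)) : L2R →ₗ.[ℂ] L2R :=
  (schurOp₀ K hA lam hd).closure

/-! ### Numerical range, resolvent set, sectors -/

/-- The numerical range `{⟨T u, u⟩ : u ∈ Dom T, ‖u‖ = 1}` of an operator in a Hilbert space;
`inner ℂ u (T u)` is linear in `T u`. -/
def numRange {H : Type*} [NormedAddCommGroup H] [InnerProductSpace ℂ H]
    (T : H →ₗ.[ℂ] H) : Set ℂ :=
  {μ | ∃ u : T.domain, ‖(u : H)‖ = 1 ∧ μ = inner ℂ (u : H) (T u)}

/-- The resolvent set: those `w` for which `T - w` is a bijection from `Dom T` onto the space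
with bounded inverse. -/
def resolventSetPMap {H : Type*} [NormedAddCommGroup H] [InnerProductSpace ℂ H]
    (T : H →ₗ.[ℂ] H) : Set ℂ :=
  {w | ∃ R : H →L[ℂ] H,
    (∀ f : H, ∃ u : T.domain, (u : H) = R f ∧ T u - w • (u : H) = f) ∧
    ∀ u : T.domain, R (T u - w • (u : H)) = u}

/-- The closed sector with vertex `z₀`, semi-angle `ϑ` and axis of direction `exp (i ψ)`. -/
def closedSector (z₀ : ℂ) (ψ ϑ : ℝ) : Set ℂ :=
  {z | ∃ r t : ℝ, 0 ≤ r ∧ |t| ≤ ϑ ∧ z = z₀ + r * Complex.exp ((ψ + t : ℝ) * Complex.I)}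

end

/-!
Multiplication by `exp (i θ)` makes the leading coefficient have real part at least `δ > 0`. Moving
half of the derivatives to the other side of the inner product and absorbing the lower-order terms
by interpolation gives Gårding's inequality, which puts the numerical range into a sector of
semi-angle less than `π / 2`. Along the segment joining the rotated operator to `D ^ (2 l) + 1`,
a Fourier multiplier that is onto on the Schwartz space, Gårding's inequality holds uniformly, so by
the method of continuity the rotated operator plus a large constant has dense range.

The numerical range is convex (Toeplitz–Hausdorff), and being contained in a sector it has a closure
with connected complement. Off that closure `T - μ` is bounded below by the distance from `μ` to the
numerical range; this lower bound is stable, so dense range spreads from one point to the whole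
complement, and closedness of the operator turns it into membership in the resolvent set.
-/

noncomputable section

section ToeplitzHausdorff

variable {V : Type*} [NormedAddCommGroup V] [InnerProductSpace ℂ V]

/-- The set of values of a sesquilinear form on the unit sphere. -/
def formRange (s : V →ₗ⋆[ℂ] V →ₗ[ℂ] ℂ) : Set ℂ :=
  {z | ∃ u : V, ‖u‖ = 1 ∧ z = s u u}

lemma exists_mem_formRange (s : V →ₗ⋆[ℂ] V →ₗ[ℂ] ℂ) {u : V} (hu : u ≠ 0) :
    ∃ z ∈ formRange s, s u u = z * (‖u‖ : ℂ) ^ 2 := by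
  have hnorm : (‖u‖ : ℂ) ≠ 0 := by exact_mod_cast norm_ne_zero_iff.2 hu
  refine ⟨_, ⟨(‖u‖ : ℂ)⁻¹ • u, norm_smul_inv_norm hu, rfl⟩, ?_⟩
  simp only [LinearMap.map_smulₛₗ₂, map_smul, map_inv₀, Complex.conj_ofReal, smul_eq_mul]
  field_simp

lemma formRange_smul_sub_inner (s : V →ₗ⋆[ℂ] V →ₗ[ℂ] ℂ) (a c : ℂ) :
    formRange (c • (s - a • innerₛₗ ℂ)) = (fun z => c * (z - a)) '' formRange s := by
  have hval {u : V} (hu : ‖u‖ = 1) :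
      (c • (s - a • innerₛₗ ℂ) : V →ₗ⋆[ℂ] V →ₗ[ℂ] ℂ) u u = c * (s u u - a) := by
    simp [hu]
  ext z
  constructor
  · rintro ⟨u, hu, rfl⟩
    exact ⟨_, ⟨u, hu, rfl⟩, (hval hu).symm⟩
  · rintro ⟨_, ⟨u, hu, rfl⟩, rfl⟩
    exact ⟨u, hu, (hval hu).symm⟩

lemma exists_ne_zero_cross_terms_im_eq_zero (α β : ℂ) :
    ∃ c : ℂ, c ≠ 0 ∧ (starRingEnd ℂ c * α + c * β).im = 0 := by
  by_cases h : β = starRingEnd ℂ α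
  · exact ⟨1, one_ne_zero, by simp [h]⟩
  · refine ⟨starRingEnd ℂ (β - starRingEnd ℂ α), (map_ne_zero _).2 (sub_ne_zero.2 h), ?_⟩
    simp only [map_sub, Complex.conj_conj, Complex.add_im, Complex.mul_im, Complex.sub_re,
      Complex.conj_re, Complex.sub_im, Complex.conj_im]
    ring

lemma linearIndependent_of_form_eq_zero_of_form_ne_zero (s : V →ₗ⋆[ℂ] V →ₗ[ℂ] ℂ) {φ ψ : V}
    (hφ : φ ≠ 0) (hφφ : s φ φ = 0) (hψψ : s ψ ψ ≠ 0) : LinearIndependent ℂ ![φ, ψ] := by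
  rw [LinearIndependent.pair_iff' hφ]
  rintro a rfl
  simp [hφφ] at hψψ

lemma Icc_zero_one_subset_formRange (s : V →ₗ⋆[ℂ] V →ₗ[ℂ] ℂ) (h₀ : 0 ∈ formRange s)
    (h₁ : 1 ∈ formRange s) {t : ℝ} (ht : t ∈ Set.Icc 0 1) : (t : ℂ) ∈ formRange s := by
  obtain ⟨φ, hφ, hφφ⟩ := h₀
  obtain ⟨ψ, hψ, hψψ⟩ := h₁
  obtain ⟨c, hc, hcross⟩ := exists_ne_zero_cross_terms_im_eq_zero (s φ ψ) (s ψ φ)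
  -- The choice of `c` makes the form real along the path `γ` from `c φ` to `ψ`, so the intermediate
  -- value theorem applies to its Rayleigh quotient.
  let γ : ℝ → V := fun r => ((1 - r : ℝ) * c) • φ + (r : ℂ) • ψ
  have hγ_ne (r : ℝ) : γ r ≠ 0 := fun h => by
    have hind := linearIndependent_of_form_eq_zero_of_form_ne_zero s
      (norm_ne_zero_iff.1 (by simp [hφ])) hφφ.symm (hψψ ▸ one_ne_zero)
    obtain ⟨h1, h2⟩ := LinearIndependent.pair_iff.1 hind _ _ h
    have hr : r = 0 := by exact_mod_cast h2
    simp [hr, hc] at h1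
  have hform (r : ℝ) : s (γ r) (γ r) =
      ((r ^ 2 + r * (1 - r) * (starRingEnd ℂ c * s φ ψ + c * s ψ φ).re : ℝ) : ℂ) := by
    have hreal : ((starRingEnd ℂ c * s φ ψ + c * s ψ φ).re : ℂ) =
        starRingEnd ℂ c * s φ ψ + c * s ψ φ := Complex.ext rfl (by simp [hcross])
    push_cast [hreal]
    simp only [γ, map_add, LinearMap.add_apply, LinearMap.map_smulₛₗ₂, map_smul, ← hφφ, ← hψψ,
      map_mul, Complex.conj_ofReal, smul_eq_mul]
    push_cast
    ring
  let R : ℝ → ℝ := fun r => (r ^ 2 + r * (1 - r) * (starRingEnd ℂ c * s φ ψ + c * s ψ φ).re) /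
    ‖γ r‖ ^ 2
  have hR : Continuous R :=
    Continuous.div (by fun_prop) (by fun_prop) fun r => pow_ne_zero 2 (norm_ne_zero_iff.2 (hγ_ne r))
  obtain ⟨r, -, hr⟩ := intermediate_value_Icc (zero_le_one' ℝ) hR.continuousOn
    (show t ∈ Set.Icc (R 0) (R 1) by simpa [R, γ, hψ] using ht)
  obtain ⟨z, hz, hzr⟩ := exists_mem_formRange s (hγ_ne r)
  have hnorm : (‖γ r‖ : ℂ) ^ 2 ≠ 0 :=
    pow_ne_zero 2 (Complex.ofReal_ne_zero.2 (norm_ne_zero_iff.2 (hγ_ne r)))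
  convert hz
  rw [← mul_left_inj' hnorm, ← hzr, hform, ← hr]
  simp only [R]
  push_cast
  exact div_mul_cancel₀ _ hnorm

/-- The **Toeplitz–Hausdorff theorem**. -/
theorem convex_formRange (s : V →ₗ⋆[ℂ] V →ₗ[ℂ] ℂ) : Convex ℝ (formRange s) := by
  rw [convex_iff_forall_pos]
  intro a ha b hb p q hp hq hpq
  rcases eq_or_ne a b with rfl | hab
  · rwa [Convex.combo_self hpq]
  have hba : b - a ≠ 0 := sub_ne_zero.2 hab.symm
  have himage := formRange_smul_sub_inner s a (b - a)⁻¹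
  have hq_mem := Icc_zero_one_subset_formRange ((b - a)⁻¹ • (s - a • innerₛₗ ℂ))
    (himage ▸ ⟨a, ha, by simp⟩) (himage ▸ ⟨b, hb, inv_mul_cancel₀ hba⟩)
    (t := q) ⟨hq.le, by linarith⟩
  obtain ⟨z, hz, hzq⟩ := himage ▸ hq_mem
  have hcombo : z = p • a + q • b := by
    rw [← eq_sub_iff_add_eq] at hpq
    rw [inv_mul_eq_iff_eq_mul₀ hba] at hzq
    simp only [hpq, Complex.real_smul]
    push_cast
    linear_combination hzq
  exact hcombo ▸ hz

end ToeplitzHausdorff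

section DenseRange

variable {𝕜 V E : Type*} [NormedField 𝕜] [AddCommGroup V] [Module 𝕜 V]
  [NormedAddCommGroup E] [NormedSpace 𝕜 E]

lemma denseRange_of_norm_sub_le {A B : V →ₗ[𝕜] E} {κ : ℝ} (hκ : κ < 1)
    (h : ∀ u, ‖B u - A u‖ ≤ κ * ‖B u‖) (hB : DenseRange B) : DenseRange A := by
  change Dense (Set.range A)
  rw [← LinearMap.coe_range, Submodule.dense_iff_topologicalClosure_eq_top]
  by_contra hne
  obtain ⟨r, hκr, hr⟩ := exists_between hκ
  obtain ⟨x, hx, hxr⟩ := riesz_lemma (LinearMap.range A).isClosed_topologicalClosure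
    (SetLike.exists_not_mem_of_ne_top _ hne rfl) hr
  have hbound (y : E) : r * ‖x‖ ≤ ‖x - y‖ + κ * ‖y‖ := by
    refine hB.induction_on y (isClosed_le (by fun_prop) (by fun_prop)) fun u => ?_
    calc r * ‖x‖ ≤ ‖x - A u‖ := hxr _ (Submodule.le_topologicalClosure _ ⟨u, rfl⟩)
      _ ≤ ‖x - B u‖ + ‖B u - A u‖ := norm_sub_le_norm_sub_add_norm_sub ..
      _ ≤ ‖x - B u‖ + κ * ‖B u‖ := by gcongr; exact h u
  have hx0 : 0 < ‖x‖ := norm_pos_iff.2 fun h0 => hx (h0 ▸ zero_mem _)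
  have := hbound x
  rw [sub_self, norm_zero, zero_add] at this
  exact absurd (le_of_mul_le_mul_right this hx0) (not_le.2 hκr)

/-- The method of continuity. -/
theorem denseRange_iff_of_isPreconnected {X : Type*} [TopologicalSpace X] {S : Set X}
    (hS : IsPreconnected S) (B : X → V →ₗ[𝕜] E)
    (hB : ∀ x ∈ S, ∀ᶠ y in nhdsWithin x S, ∀ u, ‖B y u - B x u‖ ≤ 1 / 3 * ‖B x u‖)
    {x y : X} (hx : x ∈ S) (hy : y ∈ S) : DenseRange (B x) ↔ DenseRange (B y) := by
  refine hS.induction₂ (fun x y => DenseRange (B x) ↔ DenseRange (B y)) (fun x hx => ?_)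
    (fun _ _ _ _ _ _ => Iff.trans) (fun _ _ _ _ => Iff.symm) hx hy
  filter_upwards [hB x hx] with y hxy
  have hyx (u : V) : ‖B y u - B x u‖ ≤ 1 / 2 * ‖B y u‖ := by
    linarith [hxy u, norm_le_norm_add_norm_sub (B y u) (B x u)]
  exact ⟨denseRange_of_norm_sub_le (by norm_num) fun u => norm_sub_rev (B y u) _ ▸ hxy u,
    denseRange_of_norm_sub_le (by norm_num) hyx⟩

end DenseRange

lemma denseRange_iff_of_segment {V E : Type*} [AddCommGroup V] [Module ℂ V]
    [NormedAddCommGroup E] [NormedSpace ℂ E] (A B : V →ₗ[ℂ] E) (K : ℝ)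
    (hK : ∀ s ∈ Set.Icc (0 : ℝ) 1, ∀ u, ‖(B - A) u‖ ≤ K * ‖(A + (s : ℂ) • (B - A)) u‖) :
    DenseRange A ↔ DenseRange B := by
  have hlocal : ∀ s ∈ Set.Icc (0 : ℝ) 1, ∀ᶠ t : ℝ in nhdsWithin s (Set.Icc 0 1),
      ∀ u, ‖(A + (t : ℂ) • (B - A)) u - (A + (s : ℂ) • (B - A)) u‖
        ≤ 1 / 3 * ‖(A + (s : ℂ) • (B - A)) u‖ := by
    intro s hs
    have hsmall : ∀ᶠ t in nhds s, ‖t - s‖ * K < 1 / 3 :=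
      ContinuousAt.eventually_lt (by fun_prop) continuousAt_const (by simp)
    filter_upwards [nhdsWithin_le_nhds hsmall] with t ht u
    have hdiff : (A + (t : ℂ) • (B - A)) u - (A + (s : ℂ) • (B - A)) u =
        ((t - s : ℝ) : ℂ) • (B - A) u := by
      simp only [LinearMap.add_apply, LinearMap.smul_apply]
      push_cast
      module
    calc _ = ‖t - s‖ * ‖(B - A) u‖ := by rw [hdiff, norm_smul, Complex.norm_real]
      _ ≤ ‖t - s‖ * (K * ‖(A + (s : ℂ) • (B - A)) u‖) := by gcongr; exact hK s hs u
      _ ≤ 1 / 3 * ‖(A + (s : ℂ) • (B - A)) u‖ := by rw [← mul_assoc]; gcongr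
  simpa using denseRange_iff_of_isPreconnected isPreconnected_Icc
    (fun s : ℝ => A + (s : ℂ) • (B - A)) hlocal (Set.left_mem_Icc.2 (zero_le_one' ℝ))
    (Set.right_mem_Icc.2 (zero_le_one' ℝ))

section NumericalRange

variable {H : Type*} [NormedAddCommGroup H] [InnerProductSpace ℂ H]

/-- The map `u ↦ T u - μ u`, whose domain is that of `T`. -/
def subScalar (T : H →ₗ.[ℂ] H) (μ : ℂ) : T.domain →ₗ[ℂ] H :=
  T.toFun - μ • T.domain.subtype

lemma subScalar_apply (T : H →ₗ.[ℂ] H) (μ : ℂ) (u : T.domain) :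
    subScalar T μ u = T u - μ • (u : H) := rfl

/-- The sesquilinear form `⟨u, T v⟩` of an operator, whose values on the unit sphere make up the
numerical range. -/
def operatorForm (T : H →ₗ.[ℂ] H) : T.domain →ₗ⋆[ℂ] T.domain →ₗ[ℂ] ℂ :=
  ((innerₛₗ ℂ).compl₂ T.toFun).comp T.domain.subtype

lemma formRange_operatorForm (T : H →ₗ.[ℂ] H) : formRange (operatorForm T) = numRange T := rfl

theorem convex_numRange (T : H →ₗ.[ℂ] H) : Convex ℝ (numRange T) :=
  formRange_operatorForm T ▸ convex_formRange _

lemma exists_mem_numRange (T : H →ₗ.[ℂ] H) {u : T.domain} (hu : u ≠ 0) :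
    ∃ z ∈ numRange T, inner ℂ (u : H) (T u) = z * (‖(u : H)‖ : ℂ) ^ 2 :=
  exists_mem_formRange (operatorForm T) hu

lemma mul_norm_le_norm_of_mul_sq_le_norm_inner {x y : H} {ε : ℝ}
    (h : ε * ‖x‖ ^ 2 ≤ ‖inner ℂ x y‖) : ε * ‖x‖ ≤ ‖y‖ := by
  rcases eq_or_ne x 0 with rfl | hx
  · simp
  refine le_of_mul_le_mul_left ?_ (norm_pos_iff.2 hx)
  linarith [norm_inner_le_norm (𝕜 := ℂ) x y]

lemma exists_pos_mul_norm_le_norm_subScalar (T : H →ₗ.[ℂ] H) {μ : ℂ}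
    (hμ : μ ∉ closure (numRange T)) :
    ∃ ε > 0, ∀ u : T.domain, ε * ‖(u : H)‖ ≤ ‖subScalar T μ u‖ := by
  obtain ⟨ε, hε, hdist⟩ : ∃ ε > 0, ∀ z ∈ numRange T, ε ≤ dist μ z := by
    simpa [Metric.mem_closure_iff] using hμ
  refine ⟨ε, hε, fun u => mul_norm_le_norm_of_mul_sq_le_norm_inner ?_⟩
  rcases eq_or_ne u 0 with rfl | hu
  · simp
  obtain ⟨z, hz, hzu⟩ := exists_mem_numRange T hu
  have hinner : inner ℂ (u : H) (subScalar T μ u) = (z - μ) * (‖(u : H)‖ : ℂ) ^ 2 := by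
    rw [subScalar_apply, inner_sub_right, inner_smul_right, hzu, inner_self_eq_norm_sq_to_K,
      sub_mul]
    rfl
  rw [hinner, norm_mul, norm_pow, Complex.norm_real, norm_norm, ← dist_eq_norm, dist_comm]
  gcongr
  exact hdist z hz

lemma denseRange_subScalar_iff {T : H →ₗ.[ℂ] H} {S : Set ℂ} (hS : IsPreconnected S)
    (hdisj : Disjoint S (closure (numRange T))) {μ ν : ℂ} (hμ : μ ∈ S) (hν : ν ∈ S) :
    DenseRange (subScalar T μ) ↔ DenseRange (subScalar T ν) := by
  refine denseRange_iff_of_isPreconnected hS (subScalar T) (fun x hx => ?_) hμ hν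
  obtain ⟨ε, hε, hbelow⟩ :=
    exists_pos_mul_norm_le_norm_subScalar T (Set.disjoint_left.1 hdisj hx)
  filter_upwards [nhdsWithin_le_nhds (Metric.ball_mem_nhds x (div_pos hε three_pos))] with y hy u
  have hdiff : subScalar T y u - subScalar T x u = (x - y) • (u : H) := by
    simp only [subScalar_apply]
    module
  calc ‖subScalar T y u - subScalar T x u‖
      = dist y x * ‖(u : H)‖ := by rw [hdiff, norm_smul, ← dist_eq_norm, dist_comm]
    _ ≤ ε / 3 * ‖(u : H)‖ := by gcongr; exact (Metric.mem_ball.1 hy).le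
    _ = 1 / 3 * (ε * ‖(u : H)‖) := by ring
    _ ≤ 1 / 3 * ‖subScalar T x u‖ := by gcongr; exact hbelow u

end NumericalRange

section Sector

lemma abs_tan_le_tan_iff {t ϑ : ℝ} (ht : |t| < Real.pi / 2) (hϑ : |ϑ| < Real.pi / 2) :
    |Real.tan t| ≤ Real.tan ϑ ↔ |t| ≤ ϑ := by
  have hneg : |-ϑ| < Real.pi / 2 := (abs_neg ϑ).symm ▸ hϑ
  rw [abs_le, abs_le, ← Real.tan_neg,
    Real.strictMonoOn_tan.le_iff_le (abs_lt.1 hneg) (abs_lt.1 ht),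
    Real.strictMonoOn_tan.le_iff_le (abs_lt.1 ht) (abs_lt.1 hϑ)]

lemma exists_polar_abs_le_iff {ϑ : ℝ} (hϑ₀ : 0 ≤ ϑ) (hϑ : ϑ < Real.pi / 2) {w : ℂ} :
    (∃ r t : ℝ, 0 ≤ r ∧ |t| ≤ ϑ ∧ w = r * Complex.exp (t * Complex.I)) ↔
      0 ≤ w.re ∧ |w.im| ≤ Real.tan ϑ * w.re := by
  have hϑ' : |ϑ| < Real.pi / 2 := by rwa [abs_of_nonneg hϑ₀]
  constructor
  · rintro ⟨r, t, hr, ht, rfl⟩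
    have hcos : 0 < Real.cos t := Real.cos_pos_of_mem_Ioo (abs_lt.1 (ht.trans_lt hϑ))
    have htan : |Real.tan t| ≤ Real.tan ϑ := (abs_tan_le_tan_iff (ht.trans_lt hϑ) hϑ').2 ht
    rw [Complex.re_ofReal_mul, Complex.im_ofReal_mul, Complex.exp_ofReal_mul_I_re,
      Complex.exp_ofReal_mul_I_im, ← Real.tan_mul_cos hcos.ne', mul_left_comm, abs_mul,
      abs_of_nonneg (mul_nonneg hr hcos.le)]
    exact ⟨by positivity, by gcongr⟩
  · rintro ⟨hre, him⟩
    refine ⟨‖w‖, w.arg, norm_nonneg w, ?_, (Complex.norm_mul_exp_arg_mul_I w).symm⟩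
    rcases hre.eq_or_lt with h0 | hpos
    · rw [← h0, mul_zero, abs_nonpos_iff] at him
      rw [Complex.ext (z := w) (w := 0) h0.symm him]
      simpa
    · rw [← abs_tan_le_tan_iff (Complex.abs_arg_lt_pi_div_two_iff.2 (.inl hpos)) hϑ',
        Complex.tan_arg, abs_div, abs_of_pos hpos]
      exact (div_le_iff₀ hpos).2 him

lemma mem_closedSector_iff {z₀ : ℂ} {ψ ϑ : ℝ} (hϑ₀ : 0 ≤ ϑ) (hϑ : ϑ < Real.pi / 2) {z : ℂ} :
    z ∈ closedSector z₀ ψ ϑ ↔ 0 ≤ (Complex.exp (-(ψ * Complex.I)) * (z - z₀)).re ∧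
      |(Complex.exp (-(ψ * Complex.I)) * (z - z₀)).im| ≤
        Real.tan ϑ * (Complex.exp (-(ψ * Complex.I)) * (z - z₀)).re := by
  rw [← exists_polar_abs_le_iff hϑ₀ hϑ, closedSector, Set.mem_ofPred_eq]
  refine exists₂_congr fun r t => and_congr_right fun _ => and_congr_right fun _ => ?_
  rw [Complex.exp_neg, inv_mul_eq_iff_eq_mul₀ (Complex.exp_ne_zero _), mul_left_comm,
    ← Complex.exp_add, ← add_mul, ← Complex.ofReal_add, sub_eq_iff_eq_add']

lemma isClosed_closedSector {z₀ : ℂ} {ψ ϑ : ℝ} (hϑ₀ : 0 ≤ ϑ) (hϑ : ϑ < Real.pi / 2) :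
    IsClosed (closedSector z₀ ψ ϑ) := by
  have hset : closedSector z₀ ψ ϑ = (fun z => Complex.exp (-(ψ * Complex.I)) * (z - z₀)) ⁻¹'
      ({w | 0 ≤ w.re} ∩ {w | |w.im| ≤ Real.tan ϑ * w.re}) :=
    Set.ext fun _ => mem_closedSector_iff hϑ₀ hϑ
  rw [hset]
  exact ((isClosed_le (by fun_prop) (by fun_prop)).inter
    (isClosed_le (by fun_prop) (by fun_prop))).preimage (by fun_prop)

lemma mem_closedSector_of_abs_im_le {θ M C : ℝ} {z : ℂ} (hM : 0 ≤ M)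
    (hre : 0 ≤ (Complex.exp (θ * Complex.I) * z).re + C)
    (him : |(Complex.exp (θ * Complex.I) * z).im| ≤
      M * ((Complex.exp (θ * Complex.I) * z).re + C)) :
    z ∈ closedSector (-(C * Complex.exp (-(θ * Complex.I)))) (-θ) (Real.arctan M) := by
  have hrot : Complex.exp (-((-θ : ℝ) * Complex.I)) * (z - -(C * Complex.exp (-(θ * Complex.I)))) =
      Complex.exp (θ * Complex.I) * z + C := by
    have hinv : Complex.exp (θ * Complex.I) * Complex.exp (-(θ * Complex.I)) = 1 := by
      rw [← Complex.exp_add, add_neg_cancel, Complex.exp_zero]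
    rw [Complex.ofReal_neg, neg_mul, neg_neg]
    linear_combination (C : ℂ) * hinv
  rw [mem_closedSector_iff (Real.arctan_nonneg.2 hM) (Real.arctan_lt_pi_div_two M), hrot,
    Real.tan_arctan, Complex.add_re, Complex.add_im, Complex.ofReal_re, Complex.ofReal_im, add_zero]
  exact ⟨hre, him⟩

end Sector

section Connectedness

lemma exists_re_neg_apply_lt (f : StrongDual ℝ ℂ) (hf : f Complex.I ≠ 0 ∨ 0 ≤ f 1) {y : ℂ} {u : ℝ}
    (hy : f y < u) : ∃ z : ℂ, z.re < 0 ∧ f z < u := by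
  have hf_apply (a b : ℝ) : f ⟨a, b⟩ = a * f 1 + b * f Complex.I := by
    have hab : (⟨a, b⟩ : ℂ) = a • (1 : ℂ) + b • Complex.I := by simp [Complex.ext_iff]
    rw [hab, map_add, map_smul, map_smul, smul_eq_mul, smul_eq_mul]
  rcases eq_or_ne (f Complex.I) 0 with hI | hI
  · have hf1 : 0 ≤ f 1 := hf.resolve_left (not_not.2 hI)
    refine ⟨⟨min y.re 0 - 1, 0⟩, by simp, ?_⟩
    have hy' : f y = y.re * f 1 := by rw [← Complex.eta y, hf_apply, hI, mul_zero, add_zero]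
    rw [hf_apply, hI, mul_zero, add_zero]
    have : (min y.re 0 - 1) * f 1 ≤ y.re * f 1 := by gcongr; linarith [min_le_left y.re 0]
    linarith
  · refine ⟨⟨-1, (u - 1 + f 1) / f Complex.I⟩, by simp, ?_⟩
    rw [hf_apply, div_mul_cancel₀ _ hI]
    linarith

lemma isPreconnected_compl_of_subset_cone {C : Set ℂ} (hconv : Convex ℝ C) (hclosed : IsClosed C)
    {M : ℝ} (hM : 0 ≤ M) (hcone : ∀ z ∈ C, 0 ≤ z.re ∧ |z.im| ≤ M * z.re) : IsPreconnected Cᶜ := by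
  have hre_neg : {z : ℂ | z.re < 0} ⊆ Cᶜ := fun z hz hzC => hz.not_ge (hcone z hzC).1
  have hconn_re : IsPreconnected {z : ℂ | z.re < 0} := (convex_halfSpace_re_lt 0).isPreconnected
  refine isPreconnected_of_forall (-1) fun y hy => ?_
  obtain ⟨f, u, hyu, hu⟩ := geometric_hahn_banach_point_closed hconv hclosed hy
  have hf_lt : {z | f z < u} ⊆ Cᶜ := fun z hz hzC => (hu z hzC).not_gt hz
  have hconn_f : IsPreconnected {z | f z < u} :=
    (convex_halfSpace_lt f.toLinearMap.isLinear u).isPreconnected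
  by_cases hf : f Complex.I ≠ 0 ∨ 0 ≤ f 1
  · obtain ⟨z, hz, hzu⟩ := exists_re_neg_apply_lt f hf hyu
    exact ⟨_, Set.union_subset hre_neg hf_lt, .inl (by simp), .inr hyu,
      hconn_re.union z hz hzu hconn_f⟩
  -- Here `f` is a negative multiple of `Re`, so `Re`, and with it `Im`, is bounded above on `C`:
  -- a half-plane `{Im > L}` meets both `{Re < 0}` and `{f < u}`.
  obtain ⟨hI, hf1⟩ : f Complex.I = 0 ∧ f 1 < 0 := by simpa using hf
  have hf_im (z : ℂ) (b : ℝ) : f (z + b • Complex.I) = f z := by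
    rw [map_add, map_smul, hI, smul_zero, add_zero]
  have him_bound : ∀ z ∈ C, z.im ≤ M * (u / f 1) := fun z hz => by
    have hfz : f z = z.re * f 1 := by
      conv_lhs => rw [← Complex.re_add_im z, ← mul_one (z.re : ℂ), ← Complex.real_smul,
        ← Complex.real_smul, hf_im, map_smul, smul_eq_mul]
    have hre : z.re ≤ u / f 1 := (le_div_iff_of_neg hf1).2 (hfz ▸ hu z hz).le
    exact (le_abs_self _).trans ((hcone z hz).2.trans (by gcongr))
  have him_gt : {z : ℂ | M * (u / f 1) < z.im} ⊆ Cᶜ := fun z hz hzC => (him_bound z hzC).not_gt hz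
  have hconn_im : IsPreconnected {z : ℂ | M * (u / f 1) < z.im} :=
    (convex_halfSpace_im_gt _).isPreconnected
  generalize M * (u / f 1) = L at him_gt hconn_im
  have him_lift : L < (y + (L - y.im + 1) • Complex.I).im := by
    rw [Complex.add_im, Complex.smul_im, Complex.I_im, smul_eq_mul]
    linarith
  have hbridge := (hconn_re.union ⟨-1, L + 1⟩ (by simp) (by simp) hconn_im).union
    (y + (L - y.im + 1) • Complex.I) (.inr him_lift) ((hf_im y _).trans_lt hyu) hconn_f
  exact ⟨_, Set.union_subset (Set.union_subset hre_neg him_gt) hf_lt, .inl (.inl (by simp)),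
    .inr hyu, hbridge⟩

theorem isPreconnected_compl_of_subset_closedSector {C : Set ℂ} (hconv : Convex ℝ C)
    (hclosed : IsClosed C) {z₀ : ℂ} {ψ ϑ : ℝ} (hϑ₀ : 0 ≤ ϑ) (hϑ : ϑ < Real.pi / 2)
    (hC : C ⊆ closedSector z₀ ψ ϑ) : IsPreconnected Cᶜ := by
  have hexp : Complex.exp (-(ψ * Complex.I)) ≠ 0 := Complex.exp_ne_zero _
  let e : ℂ ≃ₜ ℂ := (Homeomorph.addLeft (-z₀)).trans (Homeomorph.mulLeft₀ _ hexp)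
  have he (z : ℂ) : e z = Complex.exp (-(ψ * Complex.I)) * (z - z₀) := by rw [sub_eq_neg_add]; rfl
  have himage : Convex ℝ (e '' C) := by
    have := (hconv.translate (-z₀)).linear_image
      (LinearMap.mulLeft ℝ (Complex.exp (-(ψ * Complex.I))))
    rwa [Set.image_image] at this
  have := isPreconnected_compl_of_subset_cone himage (e.isClosed_image.2 hclosed)
    (Real.tan_nonneg_of_nonneg_of_le_pi_div_two hϑ₀ hϑ.le) (by
      rintro _ ⟨z, hz, rfl⟩
      exact he z ▸ (mem_closedSector_iff hϑ₀ hϑ).1 (hC hz))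
  rwa [← Set.image_compl_eq e.bijective, e.isPreconnected_image] at this

end Connectedness

section ClosedOperators

variable {H : Type*} [NormedAddCommGroup H] [InnerProductSpace ℂ H]

/-- The map `(u, S u) ↦ S u - μ u` on the graph of `S`, which for a closed operator is a bounded
map between complete spaces. -/
def graphSubScalar (S : H →ₗ.[ℂ] H) (μ : ℂ) : S.graph →L[ℂ] H :=
  (ContinuousLinearMap.snd ℂ H H - μ • ContinuousLinearMap.fst ℂ H H) ∘L S.graph.subtypeL

lemma graphSubScalar_apply (S : H →ₗ.[ℂ] H) (μ : ℂ) (u : S.domain) :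
    graphSubScalar S μ ⟨(u, S u), S.mem_graph u⟩ = subScalar S μ u := rfl

lemma exists_antilipschitzWith_graphSubScalar {S : H →ₗ.[ℂ] H} {μ : ℂ} {ε : ℝ} (hε : 0 < ε)
    (hbelow : ∀ u : S.domain, ε * ‖(u : H)‖ ≤ ‖subScalar S μ u‖) :
    ∃ c, AntilipschitzWith c (graphSubScalar S μ) := by
  refine ⟨⟨1 + (1 + ‖μ‖) / ε, by positivity⟩,
    AddMonoidHomClass.antilipschitz_of_bound _ fun ⟨q, hq⟩ => ?_⟩
  obtain ⟨u, rfl⟩ := S.mem_graph_iff'.1 hq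
  rw [graphSubScalar_apply]
  have hu : ‖(u : H)‖ ≤ ‖subScalar S μ u‖ / ε := (le_div_iff₀' hε).2 (hbelow u)
  have hSu : ‖S u‖ ≤ ‖subScalar S μ u‖ + ‖μ‖ * ‖(u : H)‖ := by
    rw [← norm_smul]
    exact norm_le_norm_sub_add (S u) _
  calc max ‖(u : H)‖ ‖S u‖ ≤ ‖subScalar S μ u‖ + (1 + ‖μ‖) * ‖(u : H)‖ := by
        refine max_le ?_ ?_ <;>
          nlinarith [norm_nonneg (u : H), norm_nonneg μ, norm_nonneg (subScalar S μ u)]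
    _ ≤ ‖subScalar S μ u‖ + (1 + ‖μ‖) * (‖subScalar S μ u‖ / ε) := by gcongr
    _ = (1 + (1 + ‖μ‖) / ε) * ‖subScalar S μ u‖ := by ring

lemma mem_resolventSetPMap_of_denseRange [CompleteSpace H] {S : H →ₗ.[ℂ] H} (hS : S.IsClosed)
    {μ : ℂ} (hμ : μ ∉ closure (numRange S)) (hdense : DenseRange (subScalar S μ)) :
    μ ∈ resolventSetPMap S := by
  have : CompleteSpace S.graph := hS.completeSpace_coe
  obtain ⟨ε, hε, hbelow⟩ := exists_pos_mul_norm_le_norm_subScalar S hμ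
  have hrange : (graphSubScalar S μ).range.topologicalClosure = ⊤ := by
    rw [← Submodule.dense_iff_topologicalClosure_eq_top]
    refine hdense.mono ?_
    rintro _ ⟨u, rfl⟩
    exact ⟨_, graphSubScalar_apply S μ u⟩
  have hbij := (graphSubScalar S μ).bijective_iff_dense_range_and_antilipschitz.2
    ⟨hrange, exists_antilipschitzWith_graphSubScalar hε hbelow⟩
  let Φ := ContinuousLinearEquiv.ofBijective (graphSubScalar S μ)
    (LinearMap.ker_eq_bot.2 hbij.1) (LinearMap.range_eq_top.2 hbij.2)
  refine ⟨ContinuousLinearMap.fst ℂ H H ∘L S.graph.subtypeL ∘L Φ.symm, fun f => ?_, fun u => ?_⟩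
  · obtain ⟨u, hu⟩ := S.mem_graph_iff'.1 (Φ.symm f).2
    refine ⟨u, congrArg Prod.fst hu, ?_⟩
    rw [← subScalar_apply, ← graphSubScalar_apply, ← Φ.apply_symm_apply f]
    exact congrArg Φ (Subtype.ext hu)
  · have hu : Φ.symm (S u - μ • (u : H)) = ⟨(u, S u), S.mem_graph u⟩ :=
      Φ.symm_apply_apply ⟨(u, S u), S.mem_graph u⟩
    simp [hu]

lemma mul_norm_sq_le_re_inner_of_mem_topologicalClosure {T : H →ₗ.[ℂ] H} {e : ℂ} {r : ℝ}
    (hr : ∀ z ∈ numRange T, r ≤ (e * z).re) {p : H × H} (hp : p ∈ T.graph.topologicalClosure) :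
    r * ‖p.1‖ ^ 2 ≤ (e * inner ℂ p.1 p.2).re := by
  have hclosed : IsClosed {p : H × H | r * ‖p.1‖ ^ 2 ≤ (e * inner ℂ p.1 p.2).re} :=
    isClosed_le (by fun_prop) (by fun_prop)
  refine closure_minimal (fun q hq => ?_) hclosed hp
  obtain ⟨u, rfl⟩ := T.mem_graph_iff'.1 hq
  rcases eq_or_ne u 0 with rfl | hu0
  · simp
  obtain ⟨z, hz, hzu⟩ := exists_mem_numRange T hu0
  have hre : (e * inner ℂ (u : H) (T u)).re = (e * z).re * ‖(u : H)‖ ^ 2 := by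
    rw [hzu, ← mul_assoc, ← Complex.ofReal_pow, Complex.re_mul_ofReal]
  change r * ‖(u : H)‖ ^ 2 ≤ (e * inner ℂ (u : H) (T u)).re
  rw [hre]
  gcongr
  exact hr z hz

lemma nonneg_of_forall_pos_mul_le {a b : ℝ} (h : ∀ t > 0, t * a ≤ b) : 0 ≤ b := by
  have htendsto : Filter.Tendsto (fun t : ℝ => t * a) (nhdsWithin 0 (Set.Ioi 0)) (nhds 0) := by
    simpa using (show Continuous fun t : ℝ => t * a by fun_prop).continuousWithinAt
      (s := Set.Ioi 0) (x := 0) |>.tendsto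
  exact le_of_tendsto htendsto (Filter.eventually_of_mem self_mem_nhdsWithin h)

theorem isClosable_of_le_re_mul {T : H →ₗ.[ℂ] H} (hT : Dense (T.domain : Set H)) {e : ℂ}
    (he : e ≠ 0) {r : ℝ} (hr : ∀ z ∈ numRange T, r ≤ (e * z).re) : T.IsClosable := by
  refine ⟨T.graph.topologicalClosure.toLinearPMap,
    (Submodule.toLinearPMap_graph_eq _ fun p hp hp1 => ?_).symm⟩
  obtain ⟨x, v⟩ := p
  obtain rfl : x = 0 := hp1
  -- Test the closure of the graph with `(0, v) + t (w, T w)` and let `t → 0+`.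
  have hdom (w : T.domain) : 0 ≤ (e * inner ℂ (w : H) v).re := by
    refine nonneg_of_forall_pos_mul_le
      (a := r * ‖(w : H)‖ ^ 2 - (e * inner ℂ (w : H) (T w)).re) fun t ht => ?_
    have hw : ((w : H), T w) ∈ T.graph.topologicalClosure :=
      T.graph.le_topologicalClosure (T.mem_graph w)
    have htest := mul_norm_sq_le_re_inner_of_mem_topologicalClosure hr
      (add_mem hp (Submodule.smul_mem _ (t : ℂ) hw))
    simp only [Prod.smul_mk, Prod.mk_add_mk, zero_add, norm_smul, inner_add_right,
      inner_smul_left, inner_smul_right, Complex.conj_ofReal, Complex.norm_real,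
      Real.norm_of_nonneg ht.le] at htest
    have hexpand : (e * (t * inner ℂ (w : H) v + t * (t * inner ℂ (w : H) (T w)))).re =
        t * (e * inner ℂ (w : H) v).re + t ^ 2 * (e * inner ℂ (w : H) (T w)).re := by
      rw [← Complex.re_ofReal_mul, ← Complex.re_ofReal_mul, ← Complex.add_re]
      congr 1
      push_cast
      ring
    exact le_of_mul_le_mul_left (by linarith) ht
  have hall (w : H) : 0 ≤ (e * inner ℂ w v).re :=
    hT.induction (P := fun w => 0 ≤ (e * inner ℂ w v).re) (fun w hw => hdom ⟨w, hw⟩)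
      (isClosed_le (by fun_prop) (by fun_prop)) w
  have hneg := hall (-(e • v))
  rw [inner_neg_left, inner_smul_left, mul_neg, ← mul_assoc, Complex.mul_conj,
    inner_self_eq_norm_sq_to_K] at hneg
  have hnonpos : Complex.normSq e * ‖v‖ ^ 2 ≤ 0 := by
    simpa [← Complex.ofReal_pow, ← Complex.ofReal_mul] using hneg
  have hv : ‖v‖ ^ 2 ≤ 0 := nonpos_of_mul_nonpos_right hnonpos (Complex.normSq_pos.2 he)
  simpa using hv

lemma numRange_closure_subset {T : H →ₗ.[ℂ] H} (hT : T.IsClosable) :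
    numRange T.closure ⊆ closure (numRange T) := by
  rintro _ ⟨u, hu, rfl⟩
  have hgraph : ((u : H), T.closure u) ∈ closure (T.graph : Set (H × H)) := by
    have := T.closure.mem_graph u
    rwa [← hT.graph_closure_eq_closure_graph] at this
  have hmem : ((u : H), T.closure u) ∈ closure ({p : H × H | p.1 ≠ 0} ∩ T.graph) :=
    (isOpen_ne_fun continuous_fst continuous_const).inter_closure
      ⟨fun h : (u : H) = 0 => by simp [h] at hu, hgraph⟩
  have hcont : ContinuousAt (fun p : H × H => inner ℂ p.1 p.2 / (‖p.1‖ : ℂ) ^ 2)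
      (↑u, T.closure u) :=
    ContinuousAt.div (by fun_prop) (by fun_prop) (by simp [hu])
  have hquot : Set.MapsTo (fun p : H × H => inner ℂ p.1 p.2 / (‖p.1‖ : ℂ) ^ 2)
      ({p : H × H | p.1 ≠ 0} ∩ T.graph) (numRange T) := by
    rintro p ⟨hp0, hp⟩
    obtain ⟨w, rfl⟩ := T.mem_graph_iff'.1 hp
    have hw : w ≠ 0 := fun h => hp0 (by simp [h])
    obtain ⟨z, hz, hzw⟩ := exists_mem_numRange T hw
    have hnorm : (‖(w : H)‖ : ℂ) ^ 2 ≠ 0 :=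
      pow_ne_zero 2 (Complex.ofReal_ne_zero.2 (norm_ne_zero_iff.2 hp0))
    change inner ℂ (w : H) (T w) / (‖(w : H)‖ : ℂ) ^ 2 ∈ numRange T
    rw [hzw]
    simpa only [mul_div_cancel_right₀ z hnorm] using hz
  simpa [hu] using hcont.continuousWithinAt.mem_closure hmem hquot

theorem compl_closure_numRange_subset_resolventSetPMap [CompleteSpace H] {S : H →ₗ.[ℂ] H}
    (hS : S.IsClosed) {z₀ : ℂ} {ψ ϑ : ℝ} (hϑ₀ : 0 ≤ ϑ) (hϑ : ϑ < Real.pi / 2)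
    (hsector : numRange S ⊆ closedSector z₀ ψ ϑ) {μ₀ : ℂ} (hμ₀ : μ₀ ∉ closure (numRange S))
    (hdense : DenseRange (subScalar S μ₀)) :
    (closure (numRange S))ᶜ ⊆ resolventSetPMap S := by
  have hconn : IsPreconnected (closure (numRange S))ᶜ :=
    isPreconnected_compl_of_subset_closedSector (convex_numRange S).closure isClosed_closure
      hϑ₀ hϑ (closure_minimal hsector (isClosed_closedSector hϑ₀ hϑ))
  exact fun μ hμ => mem_resolventSetPMap_of_denseRange hS hμ <|
    (denseRange_subScalar_iff hconn disjoint_compl_left hμ₀ hμ).1 hdense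

theorem closure_numRange_closure_subset_and_compl_subset [CompleteSpace H] {T : H →ₗ.[ℂ] H}
    (hT : Dense (T.domain : Set H)) {z₀ : ℂ} {ψ ϑ : ℝ} (hϑ₀ : 0 ≤ ϑ) (hϑ : ϑ < Real.pi / 2)
    (hsector : numRange T ⊆ closedSector z₀ ψ ϑ) {μ₀ : ℂ} (hμ₀ : μ₀ ∉ closure (numRange T))
    (hdense : DenseRange (subScalar T μ₀)) :
    closure (numRange T.closure) ⊆ closedSector z₀ ψ ϑ ∧
      (closure (numRange T.closure))ᶜ ⊆ resolventSetPMap T.closure := by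
  have hclosable : T.IsClosable := by
    refine isClosable_of_le_re_mul hT (Complex.exp_ne_zero (-(ψ * Complex.I)))
      (r := (Complex.exp (-(ψ * Complex.I)) * z₀).re) fun z hz => ?_
    have := ((mem_closedSector_iff hϑ₀ hϑ).1 (hsector hz)).1
    rwa [mul_sub, Complex.sub_re, sub_nonneg] at this
  have hclosure : closure (numRange T.closure) ⊆ closure (numRange T) :=
    closure_minimal (numRange_closure_subset hclosable) isClosed_closure
  have hclosureSector : closure (numRange T.closure) ⊆ closedSector z₀ ψ ϑ :=
    hclosure.trans (closure_minimal hsector (isClosed_closedSector hϑ₀ hϑ))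
  refine ⟨hclosureSector, compl_closure_numRange_subset_resolventSetPMap
    hclosable.closure_isClosed hϑ₀ hϑ (subset_closure.trans hclosureSector)
    (fun h => hμ₀ (hclosure h)) (hdense.mono ?_)⟩
  rintro _ ⟨u, rfl⟩
  exact ⟨⟨u, T.le_closure.1 u.2⟩, by
    rw [subScalar_apply, subScalar_apply, ← T.le_closure.2 (x := u) rfl]⟩

end ClosedOperators

section RelativeBounds

variable {X : Type*} {f f' g h k : X → ℝ}

/-- Relative bound zero in the sense of Kato, for real functions: `f` is bounded by an arbitrarily
small multiple of `g`, at the expense of a large multiple of `h`. It is used for functions that are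
norms, or squares of norms, of derivatives. -/
def RelBoundZero (f g h : X → ℝ) : Prop :=
  ∀ ε > 0, ∃ C, 0 ≤ C ∧ ∀ x, f x ≤ ε * g x + C * h x

namespace RelBoundZero

lemma of_le (hg : ∀ x, 0 ≤ g x) {C : ℝ} (hC : 0 ≤ C) (hf : ∀ x, f x ≤ C * h x) :
    RelBoundZero f g h := fun _ hε =>
  ⟨C, hC, fun x => (hf x).trans (le_add_of_nonneg_left (mul_nonneg hε.le (hg x)))⟩

lemma exists_le (hf : RelBoundZero f g h) : ∃ C, 0 ≤ C ∧ ∀ x, f x ≤ g x + C * h x := by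
  simpa only [one_mul] using hf 1 one_pos

lemma mono (hf : RelBoundZero f g h) (hle : ∀ x, f' x ≤ f x) : RelBoundZero f' g h :=
  fun ε hε => (hf ε hε).imp fun _ ⟨hC, hfx⟩ => ⟨hC, fun x => (hle x).trans (hfx x)⟩

lemma add (hf : RelBoundZero f g h) (hf' : RelBoundZero f' g h) :
    RelBoundZero (fun x => f x + f' x) g h := fun ε hε => by
  obtain ⟨C, hC, hfx⟩ := hf (ε / 2) (half_pos hε)
  obtain ⟨C', hC', hfx'⟩ := hf' (ε / 2) (half_pos hε)
  exact ⟨C + C', add_nonneg hC hC', fun x => by linarith [hfx x, hfx' x]⟩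

lemma const_mul (hf : RelBoundZero f g h) (hg : ∀ x, 0 ≤ g x) (hh : ∀ x, 0 ≤ h x) {a : ℝ}
    (ha : 0 ≤ a) : RelBoundZero (fun x => a * f x) g h := fun ε hε => by
  obtain ⟨C, hC, hfx⟩ := hf (ε / (a + 1)) (by positivity)
  refine ⟨(a + 1) * C, by positivity, fun x => ?_⟩
  have hpos : 0 ≤ ε / (a + 1) * g x + C * h x :=
    add_nonneg (mul_nonneg (by positivity) (hg x)) (mul_nonneg hC (hh x))
  calc a * f x ≤ a * (ε / (a + 1) * g x + C * h x) := by gcongr; exact hfx x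
    _ ≤ (a + 1) * (ε / (a + 1) * g x + C * h x) := by gcongr; linarith
    _ = ε * g x + (a + 1) * C * h x := by field_simp

lemma trans (hf : RelBoundZero f g h) (hg : RelBoundZero g k h) : RelBoundZero f k h :=
  fun ε hε => by
    obtain ⟨C, hC, hfx⟩ := hf 1 one_pos
    obtain ⟨C', hC', hgx⟩ := hg ε hε
    exact ⟨C + C', add_nonneg hC hC', fun x => by linarith [hfx x, hgx x]⟩

lemma of_sq_le_mul (hg : ∀ x, 0 ≤ g x) (hk : ∀ x, 0 ≤ k x) (hh : ∀ x, 0 ≤ h x)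
    (hsq : ∀ x, g x ^ 2 ≤ f x * k x) (hf : RelBoundZero f g h) : RelBoundZero g k h :=
  fun ε hε => by
    obtain ⟨C, hC, hfx⟩ := hf (ε / 2) (half_pos hε)
    refine ⟨2 / ε * C, by positivity, fun x => ?_⟩
    rcases le_total (g x) (2 / ε * C * h x) with hle | hle
    · exact hle.trans (le_add_of_nonneg_left (mul_nonneg hε.le (hk x)))
    have hgk : g x ≤ ε * k x := by
      rcases (hg x).eq_or_lt with h0 | hpos
      · rw [← h0]
        exact mul_nonneg hε.le (hk x)
      have hCh : C * h x ≤ ε / 2 * g x := by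
        calc C * h x = ε / 2 * (2 / ε * C * h x) := by field_simp
          _ ≤ ε / 2 * g x := by gcongr
      have hfg : f x ≤ ε * g x := by linarith [hfx x]
      refine le_of_mul_le_mul_left ?_ hpos
      calc g x * g x = g x ^ 2 := (pow_two _).symm
        _ ≤ ε * g x * k x := (hsq x).trans (mul_le_mul_of_nonneg_right hfg (hk x))
        _ = g x * (ε * k x) := by ring
    exact hgk.trans (le_add_of_nonneg_right (mul_nonneg (by positivity) (hh x)))

lemma mul (hf' : ∀ x, 0 ≤ f' x) (hg : ∀ x, 0 ≤ g x) (hh : ∀ x, 0 ≤ h x)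
    (hf : RelBoundZero f g h) {B : ℝ} (hB : 0 ≤ B) (hf'g : ∀ x, f' x ≤ g x + B * h x) :
    RelBoundZero (fun x => f x * f' x) (fun x => g x ^ 2) (fun x => h x ^ 2) := fun ε hε => by
  obtain ⟨C, hC, hfx⟩ := hf (ε / 2) (half_pos hε)
  set A : ℝ := C + ε / 2 * B
  refine ⟨A ^ 2 / (2 * ε) + C * B, by positivity, fun x => ?_⟩
  have hmixed : A * (g x * h x) ≤ ε / 2 * g x ^ 2 + A ^ 2 / (2 * ε) * h x ^ 2 := by
    have hsq : 0 ≤ (ε * g x - A * h x) ^ 2 / (2 * ε) := by positivity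
    have hexpand : (ε * g x - A * h x) ^ 2 / (2 * ε) =
        ε / 2 * g x ^ 2 + A ^ 2 / (2 * ε) * h x ^ 2 - A * (g x * h x) := by
      field_simp
      ring
    linarith
  have hpos : 0 ≤ ε / 2 * g x + C * h x :=
    add_nonneg (mul_nonneg (half_pos hε).le (hg x)) (mul_nonneg hC (hh x))
  calc f x * f' x ≤ (ε / 2 * g x + C * h x) * (g x + B * h x) :=
        mul_le_mul (hfx x) (hf'g x) (hf' x) hpos
    _ = ε / 2 * g x ^ 2 + A * (g x * h x) + C * B * h x ^ 2 := by ring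
    _ ≤ _ := by linarith

lemma norm_of_mem_span {M E : Type*} [AddCommGroup M] [Module ℂ M] [NormedAddCommGroup E]
    [NormedSpace ℂ E] (hg : ∀ x, 0 ≤ g x) (hh : ∀ x, 0 ≤ h x) (Φ : X → M →ₗ[ℂ] E) {s : Set M}
    (hs : ∀ L ∈ s, RelBoundZero (fun x => ‖Φ x L‖) g h) {L : M} (hL : L ∈ Submodule.span ℂ s) :
    RelBoundZero (fun x => ‖Φ x L‖) g h := by
  induction hL using Submodule.span_induction with
  | mem L hL => exact hs L hL
  | zero => exact of_le hg (le_refl 0) fun x => by simp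
  | add L L' _ _ hL hL' => exact (hL.add hL').mono fun x => by rw [map_add]; exact norm_add_le _ _
  | smul c L _ hL =>
    exact (hL.const_mul hg hh (norm_nonneg c)).mono fun x => by rw [map_smul, norm_smul]

end RelBoundZero

end RelativeBounds

section BoundedCoefficients

variable {q : ℝ → ℂ}

lemma IsBInfty.deriv (hq : IsBInfty q) : IsBInfty (deriv q) := by
  refine ⟨(contDiff_infty_iff_deriv.1 hq.1).2, fun j => ?_⟩
  rw [← iteratedDeriv_succ']
  exact hq.2 (j + 1)

lemma IsBInfty.hasTemperateGrowth (hq : IsBInfty q) : q.HasTemperateGrowth := by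
  refine ⟨hq.1, fun j => ?_⟩
  obtain ⟨C, hC⟩ := hq.2 j
  exact ⟨0, C, fun x => by
    rw [pow_zero, mul_one, norm_iteratedFDeriv_eq_norm_iteratedDeriv]; exact hC x⟩

lemma IsBInfty.exists_norm_le (hq : IsBInfty q) : ∃ C, 0 ≤ C ∧ ∀ x, ‖q x‖ ≤ C := by
  obtain ⟨C, hC⟩ := hq.2 0
  rw [iteratedDeriv_zero] at hC
  exact ⟨C, (norm_nonneg _).trans (hC 0), hC⟩

lemma isBInfty_const (c : ℂ) : IsBInfty fun _ => c := by
  refine ⟨contDiff_const, fun j => ⟨‖c‖, fun x => ?_⟩⟩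
  rw [iteratedDeriv_const]
  split_ifs <;> simp

lemma IsBInfty.const_mul (hq : IsBInfty q) (c : ℂ) : IsBInfty fun x => c * q x := by
  refine ⟨contDiff_const.mul hq.1, fun j => ?_⟩
  obtain ⟨C, hC⟩ := hq.2 j
  refine ⟨‖c‖ * C, fun x => ?_⟩
  rw [iteratedDeriv_const_mul_field, norm_mul]
  exact mul_le_mul_of_nonneg_left (hC x) (norm_nonneg c)

lemma iteratedDeriv_conj (j : ℕ) (q : ℝ → ℂ) :
    iteratedDeriv j (fun x => (starRingEnd ℂ) (q x)) =
      fun x => (starRingEnd ℂ) (iteratedDeriv j q x) := by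
  induction j with
  | zero => simp
  | succ j ih =>
    rw [iteratedDeriv_succ, ih, iteratedDeriv_succ]
    funext x
    exact deriv.star

lemma IsBInfty.conj (hq : IsBInfty q) : IsBInfty fun x => (starRingEnd ℂ) (q x) := by
  refine ⟨Complex.conjCLE.contDiff.comp hq.1, fun j => ?_⟩
  obtain ⟨C, hC⟩ := hq.2 j
  refine ⟨C, fun x => ?_⟩
  rw [iteratedDeriv_conj, RCLike.norm_conj]
  exact hC x

end BoundedCoefficients

section SchwartzOperators

variable {q : ℝ → ℂ}

/-- The inclusion of the Schwartz space into `L²(ℝ)`. -/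
def toL2R : 𝓢(ℝ, ℂ) →ₗ[ℂ] L2R := (SchwartzMap.toLpCLM ℂ ℂ 2 volume).toLinearMap

/-- The momentum operator `-i d/dx` on the Schwartz space. -/
def momentumOp : Module.End ℂ 𝓢(ℝ, ℂ) :=
  (-Complex.I) • (SchwartzMap.derivCLM ℂ ℂ).toLinearMap

/-- Multiplication by `q` on the Schwartz space; it is the zero operator unless `q` has temperate
growth. -/
def mulOp (q : ℝ → ℂ) : Module.End ℂ 𝓢(ℝ, ℂ) := (SchwartzMap.smulLeftCLM ℂ q).toLinearMap

lemma coeFn_toL2R (φ : 𝓢(ℝ, ℂ)) : (toL2R φ : ℝ → ℂ) =ᵐ[volume] φ :=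
  φ.coeFn_toLp 2 volume

lemma denseRange_toL2R : DenseRange toL2R :=
  SchwartzMap.denseRange_toLpCLM (F := ℂ) (μ := (volume : Measure ℝ)) ENNReal.ofNat_ne_top

lemma inner_toL2R (φ ψ : 𝓢(ℝ, ℂ)) :
    inner ℂ (toL2R φ) (toL2R ψ) = ∫ x, (starRingEnd ℂ) (φ x) * ψ x := by
  refine (SchwartzMap.inner_toL2_toL2_eq φ ψ).trans (integral_congr_ae (.of_forall fun x => ?_))
  simp [mul_comm]

lemma integrable_conj_mul (φ ψ : 𝓢(ℝ, ℂ)) : Integrable fun x => (starRingEnd ℂ) (φ x) * ψ x := by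
  refine (L2.integrable_inner (𝕜 := ℂ) (toL2R φ) (toL2R ψ)).congr ?_
  filter_upwards [coeFn_toL2R φ, coeFn_toL2R ψ] with x hφ hψ
  rw [hφ, hψ, RCLike.inner_apply, mul_comm]

lemma mulOp_apply (hq : IsBInfty q) (φ : 𝓢(ℝ, ℂ)) (x : ℝ) : mulOp q φ x = q x * φ x :=
  SchwartzMap.smulLeftCLM_apply_apply hq.hasTemperateGrowth φ x

lemma mulOp_const (c : ℂ) : mulOp (fun _ => c) = c • 1 := by
  ext φ x
  exact mulOp_apply (isBInfty_const c) φ x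

lemma mulOp_const_mul (hq : IsBInfty q) (c : ℂ) : mulOp (fun x => c * q x) = c • mulOp q := by
  ext φ x
  rw [mulOp_apply (hq.const_mul c), LinearMap.smul_apply, smul_apply, mulOp_apply hq, smul_eq_mul,
    mul_assoc]

lemma momentumOp_apply (φ : 𝓢(ℝ, ℂ)) (x : ℝ) : momentumOp φ x = -Complex.I * deriv φ x := rfl

lemma momentumOp_pow_apply (j : ℕ) (φ : 𝓢(ℝ, ℂ)) (x : ℝ) :
    (momentumOp ^ j) φ x = momentumPow j φ x := by
  induction j generalizing x with
  | zero => simp [momentumPow]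
  | succ j ih =>
    rw [pow_succ', Module.End.mul_apply, momentumOp_apply, funext ih, add_comm j 1,
      ← momentumPow_momentumPow]
    simp [momentumPow]

lemma momentumOp_mul_mulOp (hq : IsBInfty q) :
    momentumOp * mulOp q = mulOp q * momentumOp + mulOp (fun x => -Complex.I * deriv q x) := by
  ext φ x
  rw [Module.End.mul_apply, momentumOp_apply, funext (mulOp_apply hq φ), LinearMap.add_apply,
    add_apply, mulOp_apply (hq.deriv.const_mul _), Module.End.mul_apply, mulOp_apply hq,
    momentumOp_apply,
    deriv_fun_mul (hq.1.differentiable (by simp)).differentiableAt φ.differentiableAt]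
  ring

lemma inner_momentumOp_left (φ ψ : 𝓢(ℝ, ℂ)) :
    inner ℂ (toL2R (momentumOp φ)) (toL2R ψ) = inner ℂ (toL2R φ) (toL2R (momentumOp ψ)) := by
  have hparts := SchwartzMap.integral_bilinear_deriv_right_eq_neg_left φ ψ
    ((ContinuousLinearMap.mul ℝ ℂ).comp (Complex.conjCLE : ℂ →L[ℝ] ℂ))
  simp only [ContinuousLinearMap.comp_apply, ContinuousLinearMap.mul_apply',
    ContinuousLinearEquiv.coe_coe, Complex.conjCLE_apply] at hparts
  simp only [inner_toL2R, momentumOp_apply, map_mul, map_neg, Complex.conj_I, neg_neg,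
    mul_assoc, mul_left_comm _ (-Complex.I)]
  rw [integral_const_mul, integral_const_mul, hparts, mul_neg, neg_mul, neg_neg]

lemma inner_momentumOp_pow_left (j : ℕ) (φ ψ : 𝓢(ℝ, ℂ)) :
    inner ℂ (toL2R ((momentumOp ^ j) φ)) (toL2R ψ) =
      inner ℂ (toL2R φ) (toL2R ((momentumOp ^ j) ψ)) := by
  induction j generalizing φ with
  | zero => rfl
  | succ j ih =>
    rw [pow_succ, Module.End.mul_apply, ih, inner_momentumOp_left, ← Module.End.mul_apply,
      ← pow_succ', ← pow_succ]

lemma inner_mulOp_right (hq : IsBInfty q) (φ ψ : 𝓢(ℝ, ℂ)) :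
    inner ℂ (toL2R φ) (toL2R (mulOp q ψ)) =
      inner ℂ (toL2R (mulOp (fun x => (starRingEnd ℂ) (q x)) φ)) (toL2R ψ) := by
  rw [inner_toL2R, inner_toL2R]
  congr 1
  funext x
  rw [mulOp_apply hq, mulOp_apply hq.conj, map_mul, Complex.conj_conj]
  ring

lemma norm_mulOp_le (hq : IsBInfty q) {C : ℝ} (hC : ∀ x, ‖q x‖ ≤ C) (φ : 𝓢(ℝ, ℂ)) :
    ‖toL2R (mulOp q φ)‖ ≤ C * ‖toL2R φ‖ := by
  refine Lp.norm_le_mul_norm_of_ae_le_mul ?_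
  filter_upwards [coeFn_toL2R φ, coeFn_toL2R (mulOp q φ)] with x hφ hqφ
  rw [hφ, hqφ, mulOp_apply hq, norm_mul]
  exact mul_le_mul_of_nonneg_right (hC x) (norm_nonneg _)

lemma re_inner_self_toL2R (φ : 𝓢(ℝ, ℂ)) : (inner ℂ (toL2R φ) (toL2R φ)).re = ‖toL2R φ‖ ^ 2 :=
  inner_self_eq_norm_sq (𝕜 := ℂ) _

lemma re_conj_mul_mulOp_apply (hq : IsBInfty q) (φ : 𝓢(ℝ, ℂ)) (x : ℝ) :
    ((starRingEnd ℂ) (φ x) * mulOp q φ x).re = (q x).re * ‖φ x‖ ^ 2 := by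
  rw [mulOp_apply hq, mul_left_comm, Complex.conj_mul', ← Complex.ofReal_pow,
    Complex.re_mul_ofReal]

lemma integrable_re_mul_norm_sq (hq : IsBInfty q) (φ : 𝓢(ℝ, ℂ)) :
    Integrable fun x => (q x).re * ‖φ x‖ ^ 2 :=
  (Complex.reCLM.integrable_comp (integrable_conj_mul φ (mulOp q φ))).congr
    (.of_forall (re_conj_mul_mulOp_apply hq φ))

lemma re_inner_mulOp (hq : IsBInfty q) (φ : 𝓢(ℝ, ℂ)) :
    (inner ℂ (toL2R φ) (toL2R (mulOp q φ))).re = ∫ x, (q x).re * ‖φ x‖ ^ 2 := by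
  rw [inner_toL2R, ← Complex.reCLM_apply,
    ← ContinuousLinearMap.integral_comp_comm _ (integrable_conj_mul φ _)]
  exact integral_congr_ae (.of_forall (re_conj_mul_mulOp_apply hq φ))

lemma le_re_inner_mulOp (hq : IsBInfty q) {δ : ℝ} (hδ : ∀ x, δ ≤ (q x).re) (φ : 𝓢(ℝ, ℂ)) :
    δ * ‖toL2R φ‖ ^ 2 ≤ (inner ℂ (toL2R φ) (toL2R (mulOp q φ))).re := by
  have hconst : IsBInfty fun _ => (δ : ℂ) := isBInfty_const δ
  calc δ * ‖toL2R φ‖ ^ 2 = (inner ℂ (toL2R φ) (toL2R (mulOp (fun _ => (δ : ℂ)) φ))).re := by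
        rw [mulOp_const, LinearMap.smul_apply, Module.End.one_apply, map_smul, inner_smul_right,
          Complex.re_ofReal_mul, re_inner_self_toL2R]
    _ = ∫ x, δ * ‖φ x‖ ^ 2 := re_inner_mulOp hconst φ
    _ ≤ ∫ x, (q x).re * ‖φ x‖ ^ 2 :=
        integral_mono (integrable_re_mul_norm_sq hconst φ) (integrable_re_mul_norm_sq hq φ)
          fun x => mul_le_mul_of_nonneg_right (hδ x) (sq_nonneg _)
    _ = _ := (re_inner_mulOp hq φ).symm

end SchwartzOperators

section DiffOps

variable {q : ℝ → ℂ} {N : ℕ} {L : Module.End ℂ 𝓢(ℝ, ℂ)}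

/-- The differential operators of order less than `N` on the Schwartz space, with coefficients
bounded together with all their derivatives. The inequality is strict so that `diffOps N` collects
the lower order terms of an operator of order `N`. -/
def diffOps (N : ℕ) : Submodule ℂ (Module.End ℂ 𝓢(ℝ, ℂ)) :=
  Submodule.span ℂ {L | ∃ j < N, ∃ q, IsBInfty q ∧ L = mulOp q * momentumOp ^ j}

lemma mulOp_mul_mem_diffOps (hq : IsBInfty q) {j : ℕ} (hj : j < N) :
    mulOp q * momentumOp ^ j ∈ diffOps N := Submodule.subset_span ⟨j, hj, q, hq, rfl⟩

lemma diffOps_mono {M : ℕ} (hNM : N ≤ M) : diffOps N ≤ diffOps M :=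
  Submodule.span_mono fun _ ⟨j, hj, q, hq, hL⟩ => ⟨j, hj.trans_le hNM, q, hq, hL⟩

lemma momentumOp_mul_mem_diffOps (hL : L ∈ diffOps N) : momentumOp * L ∈ diffOps (N + 1) := by
  induction hL using Submodule.span_induction with
  | mem L hL =>
    obtain ⟨j, hj, q, hq, rfl⟩ := hL
    rw [← mul_assoc, momentumOp_mul_mulOp hq, add_mul, mul_assoc, ← pow_succ']
    exact add_mem (mulOp_mul_mem_diffOps hq (by omega))
      (mulOp_mul_mem_diffOps (hq.deriv.const_mul _) (by omega))
  | zero => rw [mul_zero]; exact zero_mem _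
  | add L L' _ _ hL hL' => rw [mul_add]; exact add_mem hL hL'
  | smul c L _ hL => rw [mul_smul_comm]; exact Submodule.smul_mem _ c hL

lemma mul_momentumOp_pow_mem_diffOps (hL : L ∈ diffOps N) (l : ℕ) :
    L * momentumOp ^ l ∈ diffOps (N + l) := by
  induction hL using Submodule.span_induction with
  | mem L hL =>
    obtain ⟨j, hj, q, hq, rfl⟩ := hL
    rw [mul_assoc, ← pow_add]
    exact mulOp_mul_mem_diffOps hq (by omega)
  | zero => rw [zero_mul]; exact zero_mem _
  | add L L' _ _ hL hL' => rw [add_mul]; exact add_mem hL hL'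
  | smul c L _ hL => rw [smul_mul_assoc]; exact Submodule.smul_mem _ c hL

lemma momentumOp_pow_mul_mulOp_sub_mem_diffOps (hq : IsBInfty q) (i : ℕ) :
    momentumOp ^ i * mulOp q - mulOp q * momentumOp ^ i ∈ diffOps i := by
  induction i with
  | zero => simp
  | succ i ih =>
    have hcomm : momentumOp ^ (i + 1) * mulOp q - mulOp q * momentumOp ^ (i + 1) =
        momentumOp * (momentumOp ^ i * mulOp q - mulOp q * momentumOp ^ i) +
          mulOp (fun x => -Complex.I * deriv q x) * momentumOp ^ i := by
      rw [mul_sub, ← mul_assoc, ← mul_assoc, momentumOp_mul_mulOp hq, add_mul, pow_succ',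
        mul_assoc (mulOp q) momentumOp]
      abel
    rw [hcomm]
    exact add_mem (momentumOp_mul_mem_diffOps ih)
      (mulOp_mul_mem_diffOps (hq.deriv.const_mul _) i.lt_succ_self)

lemma momentumOp_pow_mul_mulOp_mem_diffOps (hq : IsBInfty q) {i : ℕ} (hi : i < N) :
    momentumOp ^ i * mulOp q ∈ diffOps N := by
  rw [← sub_add_cancel (momentumOp ^ i * mulOp q) (mulOp q * momentumOp ^ i)]
  exact add_mem (diffOps_mono hi.le (momentumOp_pow_mul_mulOp_sub_mem_diffOps hq i))
    (mulOp_mul_mem_diffOps hq hi)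

end DiffOps

section Interpolation

variable {L : Module.End ℂ 𝓢(ℝ, ℂ)}

/-- The `L²` norm of the derivative of order `j`; for `j = 0` it is the `L²` norm itself. -/
def sobolevSeminorm (j : ℕ) (φ : 𝓢(ℝ, ℂ)) : ℝ := ‖toL2R ((momentumOp ^ j) φ)‖

lemma sobolevSeminorm_nonneg (j : ℕ) (φ : 𝓢(ℝ, ℂ)) : 0 ≤ sobolevSeminorm j φ := norm_nonneg _

lemma sobolevSeminorm_zero (φ : 𝓢(ℝ, ℂ)) : sobolevSeminorm 0 φ = ‖toL2R φ‖ := rfl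

lemma sobolevSeminorm_succ_sq_le (j : ℕ) (φ : 𝓢(ℝ, ℂ)) :
    sobolevSeminorm (j + 1) φ ^ 2 ≤ sobolevSeminorm j φ * sobolevSeminorm (j + 2) φ := by
  have hparts : inner ℂ (toL2R ((momentumOp ^ (j + 1)) φ)) (toL2R ((momentumOp ^ (j + 1)) φ)) =
      inner ℂ (toL2R ((momentumOp ^ j) φ)) (toL2R ((momentumOp ^ (j + 2)) φ)) := by
    rw [pow_succ' momentumOp (j + 1), Module.End.mul_apply, ← inner_momentumOp_left,
      ← Module.End.mul_apply, ← pow_succ']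
  rw [sobolevSeminorm, ← re_inner_self_toL2R, hparts]
  exact (Complex.re_le_norm _).trans (norm_inner_le_norm _ _)

lemma relBoundZero_sobolevSeminorm_succ (j : ℕ) :
    RelBoundZero (sobolevSeminorm j) (sobolevSeminorm (j + 1)) (sobolevSeminorm 0) := by
  induction j with
  | zero => exact .of_le (sobolevSeminorm_nonneg _) zero_le_one fun φ => (one_mul _).ge
  | succ j ih =>
    exact .of_sq_le_mul (sobolevSeminorm_nonneg _) (sobolevSeminorm_nonneg _)
      (sobolevSeminorm_nonneg _) (sobolevSeminorm_succ_sq_le j) ih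

lemma relBoundZero_sobolevSeminorm {j n : ℕ} (hj : j < n) :
    RelBoundZero (sobolevSeminorm j) (sobolevSeminorm n) (sobolevSeminorm 0) := by
  induction n, hj using Nat.le_induction with
  | base => exact relBoundZero_sobolevSeminorm_succ j
  | succ n _ ih => exact ih.trans (relBoundZero_sobolevSeminorm_succ n)

lemma exists_sobolevSeminorm_le {j n : ℕ} (hj : j ≤ n) :
    ∃ C, 0 ≤ C ∧ ∀ φ, sobolevSeminorm j φ ≤ sobolevSeminorm n φ + C * sobolevSeminorm 0 φ := by
  rcases hj.lt_or_eq with hlt | rfl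
  · exact (relBoundZero_sobolevSeminorm hlt).exists_le
  · exact ⟨0, le_rfl, fun φ => by simp⟩

lemma relBoundZero_norm_of_mem_diffOps {N : ℕ} (hL : L ∈ diffOps N) :
    RelBoundZero (fun φ => ‖toL2R (L φ)‖) (sobolevSeminorm N) (sobolevSeminorm 0) := by
  refine .norm_of_mem_span (sobolevSeminorm_nonneg _) (sobolevSeminorm_nonneg _)
    (fun φ => toL2R ∘ₗ LinearMap.applyₗ φ) ?_ hL
  rintro _ ⟨j, hj, q, hq, rfl⟩
  obtain ⟨C, hC, hqC⟩ := hq.exists_norm_le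
  exact ((relBoundZero_sobolevSeminorm hj).const_mul (sobolevSeminorm_nonneg _)
    (sobolevSeminorm_nonneg _) hC).mono fun φ => norm_mulOp_le hq hqC _

lemma relBoundZero_norm_inner_of_mem_diffOps {l : ℕ} (hL : L ∈ diffOps (l + l)) :
    RelBoundZero (fun φ => ‖(inner ℂ (toL2R φ) (toL2R (L φ)) : ℂ)‖)
      (fun φ => sobolevSeminorm l φ ^ 2) (fun φ => sobolevSeminorm 0 φ ^ 2) := by
  refine .norm_of_mem_span (fun _ => sq_nonneg _) (fun _ => sq_nonneg _)
    (fun φ => (innerSL ℂ (toL2R φ)).toLinearMap ∘ₗ toL2R ∘ₗ LinearMap.applyₗ φ) ?_ hL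
  rintro _ ⟨j, hj, q, hq, rfl⟩
  obtain ⟨i, k, hi, hk, rfl⟩ : ∃ i k, i < l ∧ k ≤ l ∧ j = i + k :=
    ⟨min j (l - 1), j - min j (l - 1), by omega, by omega, by omega⟩
  obtain ⟨B, hB, hkB⟩ := exists_sobolevSeminorm_le hk
  have hlower := relBoundZero_norm_of_mem_diffOps (momentumOp_pow_mul_mulOp_mem_diffOps hq.conj hi)
  refine (hlower.mul (sobolevSeminorm_nonneg k) (sobolevSeminorm_nonneg l)
    (sobolevSeminorm_nonneg 0) hB hkB).mono fun φ => ?_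
  have hparts : inner ℂ (toL2R φ) (toL2R ((mulOp q * momentumOp ^ (i + k)) φ)) =
      inner ℂ (toL2R ((momentumOp ^ i * mulOp fun x => (starRingEnd ℂ) (q x)) φ))
        (toL2R ((momentumOp ^ k) φ)) := by
    rw [Module.End.mul_apply, inner_mulOp_right hq, pow_add, Module.End.mul_apply,
      ← inner_momentumOp_pow_left, Module.End.mul_apply]
  exact (congrArg norm hparts).trans_le (norm_inner_le_norm _ _)

end Interpolation

section Garding

variable {q : ℝ → ℂ} {l : ℕ} {L : Module.End ℂ 𝓢(ℝ, ℂ)}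

lemma mulOp_mul_momentumOp_pow_add_sub_mem_diffOps (hq : IsBInfty q) (hL : L ∈ diffOps (l + l)) :
    mulOp q * momentumOp ^ (l + l) + L - momentumOp ^ l * mulOp q * momentumOp ^ l ∈
      diffOps (l + l) := by
  have hcomm := mul_momentumOp_pow_mem_diffOps (momentumOp_pow_mul_mulOp_sub_mem_diffOps hq l) l
  convert sub_mem hL hcomm using 1
  rw [sub_mul, mul_assoc (mulOp q), ← pow_add]
  abel

lemma relBoundZero_norm_inner_sub_inner (hq : IsBInfty q) (hL : L ∈ diffOps (l + l)) :
    RelBoundZero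
      (fun φ => ‖(inner ℂ (toL2R φ) (toL2R ((mulOp q * momentumOp ^ (l + l) + L) φ)) -
        inner ℂ (toL2R ((momentumOp ^ l) φ)) (toL2R (mulOp q ((momentumOp ^ l) φ))) : ℂ)‖)
      (fun φ => sobolevSeminorm l φ ^ 2) (fun φ => sobolevSeminorm 0 φ ^ 2) := by
  refine (relBoundZero_norm_inner_of_mem_diffOps
    (mulOp_mul_momentumOp_pow_add_sub_mem_diffOps hq hL)).mono fun φ => ?_
  rw [inner_momentumOp_pow_left, ← inner_sub_right, ← map_sub]
  rfl

/-- **Gårding's inequality**. -/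
lemma garding_inequality (hq : IsBInfty q) {δ : ℝ} (hδ : 0 < δ) (hqδ : ∀ x, δ ≤ (q x).re)
    (hL : L ∈ diffOps (l + l)) :
    ∃ C, 0 ≤ C ∧ ∀ φ, δ / 2 * sobolevSeminorm l φ ^ 2 ≤
      (inner ℂ (toL2R φ) (toL2R ((mulOp q * momentumOp ^ (l + l) + L) φ))).re +
        C * sobolevSeminorm 0 φ ^ 2 := by
  obtain ⟨C, hC, hsub⟩ := relBoundZero_norm_inner_sub_inner hq hL (δ / 2) (half_pos hδ)
  refine ⟨C, hC, fun φ => ?_⟩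
  have hlead : δ * sobolevSeminorm l φ ^ 2 ≤ _ := le_re_inner_mulOp hq hqδ ((momentumOp ^ l) φ)
  have hrem := (neg_le_of_abs_le (Complex.abs_re_le_norm _)).trans' (neg_le_neg (hsub φ))
  rw [Complex.sub_re] at hrem
  linarith

lemma exists_norm_inner_le (hq : IsBInfty q) (hL : L ∈ diffOps (l + l)) :
    ∃ C, 0 ≤ C ∧ ∀ φ,
      ‖(inner ℂ (toL2R φ) (toL2R ((mulOp q * momentumOp ^ (l + l) + L) φ)) : ℂ)‖ ≤
        C * (sobolevSeminorm l φ ^ 2 + sobolevSeminorm 0 φ ^ 2) := by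
  obtain ⟨C, hC, hsub⟩ := (relBoundZero_norm_inner_sub_inner hq hL).exists_le
  obtain ⟨B, hB, hqB⟩ := hq.exists_norm_le
  refine ⟨1 + B + C, by positivity, fun φ => ?_⟩
  have hlead : ‖(inner ℂ (toL2R ((momentumOp ^ l) φ))
      (toL2R (mulOp q ((momentumOp ^ l) φ))) : ℂ)‖ ≤ B * sobolevSeminorm l φ ^ 2 := by
    calc _ ≤ sobolevSeminorm l φ * (B * sobolevSeminorm l φ) :=
          (norm_inner_le_norm _ _).trans
            (mul_le_mul_of_nonneg_left (norm_mulOp_le hq hqB _) (norm_nonneg _))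
      _ = B * sobolevSeminorm l φ ^ 2 := by ring
  refine (norm_le_norm_sub_add _ _).trans ((add_le_add (hsub φ) hlead).trans ?_)
  nlinarith [sq_nonneg (sobolevSeminorm l φ), sq_nonneg (sobolevSeminorm 0 φ),
    mul_nonneg hC (sq_nonneg (sobolevSeminorm l φ)),
    mul_nonneg hB (sq_nonneg (sobolevSeminorm 0 φ))]

end Garding

section ReferenceOperator

lemma momentumOp_eq_fourierMultiplierCLM (φ : 𝓢(ℝ, ℂ)) :
    momentumOp φ = SchwartzMap.fourierMultiplierCLM ℂ (fun x : ℝ => 2 * Real.pi * x) φ := by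
  have hinner : (fun x : ℝ => 2 * Real.pi * x) =
      (2 * Real.pi) • fun x : ℝ => inner ℝ x (1 : ℝ) := by
    funext x
    simp
  have hline : momentumOp φ = (-Complex.I) • LineDeriv.lineDerivOp (1 : ℝ) φ := by
    ext x
    rw [momentumOp_apply, smul_apply, SchwartzMap.lineDerivOp_apply_eq_fderiv, smul_eq_mul,
      fderiv_apply_one_eq_deriv]
  have hI : -Complex.I * (2 * Real.pi * Complex.I) = (2 * Real.pi : ℝ) := by
    push_cast
    linear_combination (-(2 * Real.pi : ℂ)) * Complex.I_sq
  rw [hline, SchwartzMap.lineDeriv_eq_fourierMultiplierCLM, smul_smul, hI, hinner,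
    SchwartzMap.fourierMultiplierCLM_smul (by fun_prop)]
  rfl

lemma momentumOp_pow_eq_fourierMultiplierCLM (j : ℕ) (φ : 𝓢(ℝ, ℂ)) :
    (momentumOp ^ j) φ =
      SchwartzMap.fourierMultiplierCLM ℂ (fun x : ℝ => (2 * Real.pi * x) ^ j) φ := by
  induction j with
  | zero => simp
  | succ j ih =>
    rw [pow_succ', Module.End.mul_apply, ih, momentumOp_eq_fourierMultiplierCLM,
      SchwartzMap.fourierMultiplierCLM_fourierMultiplierCLM_apply (by fun_prop) (by fun_prop)]
    congr 2
    funext x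
    rw [Pi.mul_apply, pow_succ']

lemma momentumOp_pow_add_one_surjective (l : ℕ) :
    Function.Surjective (momentumOp ^ (l + l) + 1 : Module.End ℂ 𝓢(ℝ, ℂ)) := by
  intro φ
  set p : ℝ → ℝ := fun x => (2 * Real.pi * x) ^ (l + l)
  set g : ℝ → ℝ := fun x => (1 + ‖(2 * Real.pi * x) ^ l‖ ^ 2) ^ (-1 : ℝ)
  have hp : p.HasTemperateGrowth := by fun_prop
  have hg : g.HasTemperateGrowth :=
    (Function.hasTemperateGrowth_one_add_norm_sq_rpow ℝ (-1)).comp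
      (f := fun x : ℝ => (2 * Real.pi * x) ^ l) (by fun_prop)
  have hinv (x : ℝ) : p x * g x + g x = 1 := by
    have hpos : 0 < 1 + ‖(2 * Real.pi * x) ^ l‖ ^ 2 := by positivity
    simp only [p, g, Real.rpow_neg_one, pow_add, ← pow_two, Real.norm_eq_abs, sq_abs] at hpos ⊢
    field_simp
    ring
  refine ⟨SchwartzMap.fourierMultiplierCLM ℂ g φ, ?_⟩
  rw [LinearMap.add_apply, momentumOp_pow_eq_fourierMultiplierCLM, Module.End.one_apply,
    SchwartzMap.fourierMultiplierCLM_fourierMultiplierCLM_apply hp hg]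
  refine Eq.trans ?_ (FourierTransform.fourierInv_fourier_eq (F := 𝓢(ℝ, ℂ)) φ)
  rw [SchwartzMap.fourierMultiplierCLM_apply, SchwartzMap.fourierMultiplierCLM_apply,
    ← FourierTransform.fourierInv_add]
  congr 1
  ext x
  rw [add_apply, SchwartzMap.smulLeftCLM_apply_apply (hp.mul hg),
    SchwartzMap.smulLeftCLM_apply_apply hg, ← add_smul, Pi.mul_apply, hinv, one_smul]

end ReferenceOperator

section EllipticMaps

variable {V E : Type*} [AddCommGroup V] [Module ℂ V] [NormedAddCommGroup E]
  [InnerProductSpace ℂ E] {J D A B : V →ₗ[ℂ] E} {c c' C C' : ℝ}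

/-- Quantitative ellipticity of a linear map `B`, relative to an inclusion `J` and to a map `D` in
the role of the derivative of the same order as `B`. The estimates are affine in `B`, so that they
are inherited by all convex combinations of two such maps. -/
structure IsEllipticWith (J D B : V →ₗ[ℂ] E) (c C : ℝ) : Prop where
  coercive : ∀ u, c * ‖J u‖ ^ 2 ≤ (inner ℂ (J u) (B u)).re
  elliptic : ∀ u, c * ‖D u‖ ^ 2 ≤ (inner ℂ (D u) (B u)).re + C * ‖J u‖ * ‖D u‖
  norm_le : ∀ u, ‖B u‖ ≤ C * (‖D u‖ + ‖J u‖)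

namespace IsEllipticWith

lemma mono (hB : IsEllipticWith J D B c C) (hc : c' ≤ c) (hC : C ≤ C') :
    IsEllipticWith J D B c' C' where
  coercive u := (mul_le_mul_of_nonneg_right hc (sq_nonneg _)).trans (hB.coercive u)
  elliptic u := by
    calc c' * ‖D u‖ ^ 2 ≤ c * ‖D u‖ ^ 2 := by gcongr
      _ ≤ _ := hB.elliptic u
      _ ≤ _ := by gcongr
  norm_le u := (hB.norm_le u).trans (by gcongr)

lemma convexComb (hA : IsEllipticWith J D A c C) (hB : IsEllipticWith J D B c C) {s : ℝ}
    (hs₀ : 0 ≤ s) (hs₁ : s ≤ 1) : IsEllipticWith J D (A + (s : ℂ) • (B - A)) c C := by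
  have hcomb (u : V) : (A + (s : ℂ) • (B - A)) u = ((1 - s : ℝ) : ℂ) • A u + (s : ℂ) • B u := by
    simp only [LinearMap.add_apply, LinearMap.smul_apply, LinearMap.sub_apply]
    push_cast
    module
  have hs₁' : 0 ≤ 1 - s := sub_nonneg.2 hs₁
  have hre (x : E) (u : V) : (inner ℂ x ((A + (s : ℂ) • (B - A)) u)).re =
      (1 - s) * (inner ℂ x (A u)).re + s * (inner ℂ x (B u)).re := by
    rw [hcomb, inner_add_right, inner_smul_right, inner_smul_right, Complex.add_re,
      Complex.re_ofReal_mul, Complex.re_ofReal_mul]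
  refine ⟨fun u => ?_, fun u => ?_, fun u => ?_⟩
  · rw [hre]
    linarith [mul_le_mul_of_nonneg_left (hA.coercive u) hs₁',
      mul_le_mul_of_nonneg_left (hB.coercive u) hs₀]
  · rw [hre]
    linarith [mul_le_mul_of_nonneg_left (hA.elliptic u) hs₁',
      mul_le_mul_of_nonneg_left (hB.elliptic u) hs₀]
  · calc _ ≤ (1 - s) * ‖A u‖ + s * ‖B u‖ := by
          rw [hcomb]
          refine (norm_add_le _ _).trans_eq ?_
          rw [norm_smul, norm_smul, Complex.norm_of_nonneg hs₁', Complex.norm_of_nonneg hs₀]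
      _ ≤ (1 - s) * (C * (‖D u‖ + ‖J u‖)) + s * (C * (‖D u‖ + ‖J u‖)) := by
          gcongr
          exacts [hA.norm_le u, hB.norm_le u]
      _ = C * (‖D u‖ + ‖J u‖) := by ring

lemma norm_add_norm_le (hB : IsEllipticWith J D B c C) (hc : 0 < c) (hC : 0 ≤ C) (u : V) :
    ‖D u‖ + ‖J u‖ ≤ (2 + C / c) / c * ‖B u‖ := by
  have hJ : c * ‖J u‖ ≤ ‖B u‖ :=
    mul_norm_le_norm_of_mul_sq_le_norm_inner ((hB.coercive u).trans (Complex.re_le_norm _))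
  have hD : c * ‖D u‖ ≤ ‖B u‖ + C * ‖J u‖ := by
    rcases (norm_nonneg (D u)).eq_or_lt with h0 | hpos
    · rw [← h0, mul_zero]
      positivity
    refine le_of_mul_le_mul_left ?_ hpos
    linarith [hB.elliptic u, (Complex.re_le_norm _).trans (norm_inner_le_norm (𝕜 := ℂ) (D u) (B u))]
  have hCJ : C * ‖J u‖ ≤ C / c * ‖B u‖ := by
    calc C * ‖J u‖ = C / c * (c * ‖J u‖) := by field_simp
      _ ≤ C / c * ‖B u‖ := by gcongr
  rw [div_mul_eq_mul_div, le_div_iff₀ hc]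
  linarith

lemma denseRange_iff (hA : IsEllipticWith J D A c C) (hB : IsEllipticWith J D B c C)
    (hc : 0 < c) (hC : 0 ≤ C) : DenseRange A ↔ DenseRange B := by
  refine denseRange_iff_of_segment A B (2 * C * ((2 + C / c) / c)) fun s hs u => ?_
  calc ‖(B - A) u‖ ≤ ‖B u‖ + ‖A u‖ := norm_sub_le _ _
    _ ≤ C * (‖D u‖ + ‖J u‖) + C * (‖D u‖ + ‖J u‖) := add_le_add (hB.norm_le u) (hA.norm_le u)
    _ = 2 * C * (‖D u‖ + ‖J u‖) := by ring
    _ ≤ 2 * C * ((2 + C / c) / c * ‖(A + (s : ℂ) • (B - A)) u‖) := by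
        gcongr
        exact (hA.convexComb hB hs.1 hs.2).norm_add_norm_le hc hC u
    _ = _ := by ring

lemma add_smul_of_garding (hc : 0 ≤ c) (hC' : 0 ≤ C')
    (hgarding : ∀ u, 0 ≤ (inner ℂ (J u) (B u)).re + C' * ‖J u‖ ^ 2)
    (helliptic : ∀ u, c * ‖D u‖ ^ 2 ≤ (inner ℂ (D u) (B u)).re + C * ‖J u‖ * ‖D u‖)
    (hnorm : ∀ u, ‖B u‖ ≤ C * (‖D u‖ + ‖J u‖)) :
    IsEllipticWith J D (B + ((C' + c : ℝ) : ℂ) • J) c (C + (C' + c)) := by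
  have hR : 0 ≤ C' + c := by positivity
  have hre (x : E) (u : V) : (inner ℂ x ((B + ((C' + c : ℝ) : ℂ) • J) u)).re =
      (inner ℂ x (B u)).re + (C' + c) * (inner ℂ x (J u)).re := by
    rw [LinearMap.add_apply, LinearMap.smul_apply, inner_add_right, inner_smul_right,
      Complex.add_re, Complex.re_ofReal_mul]
  refine ⟨fun u => ?_, fun u => ?_, fun u => ?_⟩
  · have hself : (inner ℂ (J u) (J u)).re = ‖J u‖ ^ 2 := inner_self_eq_norm_sq (𝕜 := ℂ) _
    rw [hre, hself]
    linarith [hgarding u]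
  · have hmixed := neg_le_of_abs_le ((Complex.abs_re_le_norm _).trans
      (norm_inner_le_norm (𝕜 := ℂ) (D u) (J u)))
    rw [hre]
    linarith [helliptic u, mul_le_mul_of_nonneg_left hmixed hR]
  · calc _ ≤ ‖B u‖ + (C' + c) * ‖J u‖ := by
          refine (norm_add_le _ _).trans_eq ?_
          rw [LinearMap.smul_apply, norm_smul, Complex.norm_of_nonneg hR]
      _ ≤ C * (‖D u‖ + ‖J u‖) + (C' + c) * (‖D u‖ + ‖J u‖) := by
          gcongr
          exacts [hnorm u, le_add_of_nonneg_left (norm_nonneg _)]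
      _ = _ := by ring

end IsEllipticWith

end EllipticMaps

section EllipticOperators

variable {q : ℝ → ℂ} {δ : ℝ} {l N : ℕ} {L : Module.End ℂ 𝓢(ℝ, ℂ)}

lemma isEllipticWith_momentumOp_pow_add (l : ℕ) :
    IsEllipticWith toL2R (toL2R ∘ₗ momentumOp ^ (l + l)) (toL2R ∘ₗ momentumOp ^ (l + l) + toL2R)
      1 2 := by
  have hshift : IsEllipticWith toL2R (toL2R ∘ₗ momentumOp ^ (l + l))
      (toL2R ∘ₗ momentumOp ^ (l + l) + ((0 + 1 : ℝ) : ℂ) • toL2R) 1 (1 + (0 + 1)) := by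
    refine .add_smul_of_garding zero_le_one le_rfl (fun φ => ?_) (fun φ => ?_) fun φ => ?_
    · rw [zero_mul, add_zero, LinearMap.comp_apply, pow_add, Module.End.mul_apply,
        ← inner_momentumOp_pow_left, re_inner_self_toL2R]
      exact sq_nonneg _
    · rw [one_mul, LinearMap.comp_apply, re_inner_self_toL2R]
      exact le_add_of_nonneg_right (by positivity)
    · rw [one_mul]
      exact le_add_of_nonneg_right (norm_nonneg _)
  simpa only [zero_add, Complex.ofReal_one, one_smul, one_add_one_eq_two] using hshift

lemma denseRange_momentumOp_pow_add (l : ℕ) :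
    DenseRange (toL2R ∘ₗ momentumOp ^ (l + l) + toL2R) := by
  have hsum : toL2R ∘ₗ momentumOp ^ (l + l) + toL2R = toL2R ∘ₗ (momentumOp ^ (l + l) + 1) := by
    rw [LinearMap.comp_add, Module.End.one_eq_id, LinearMap.comp_id]
  rw [hsum]
  exact denseRange_toL2R.comp (momentumOp_pow_add_one_surjective l).denseRange
    (SchwartzMap.toLpCLM ℂ ℂ 2 volume).continuous

lemma exists_le_re_inner_add (hq : IsBInfty q) (hδ : 0 < δ) (hqδ : ∀ x, δ ≤ (q x).re)
    (hL : L ∈ diffOps N) :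
    ∃ C, 0 ≤ C ∧ ∀ φ, δ / 2 * sobolevSeminorm N φ ^ 2 ≤
      (inner ℂ (toL2R ((momentumOp ^ N) φ)) (toL2R ((mulOp q * momentumOp ^ N + L) φ))).re +
        C * sobolevSeminorm 0 φ * sobolevSeminorm N φ := by
  obtain ⟨C, hC, hLC⟩ := relBoundZero_norm_of_mem_diffOps hL (δ / 2) (half_pos hδ)
  refine ⟨C, hC, fun φ => ?_⟩
  have hlead : δ * sobolevSeminorm N φ ^ 2 ≤ _ := le_re_inner_mulOp hq hqδ ((momentumOp ^ N) φ)
  have hrem : |(inner ℂ (toL2R ((momentumOp ^ N) φ)) (toL2R (L φ))).re| ≤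
      sobolevSeminorm N φ * (δ / 2 * sobolevSeminorm N φ + C * sobolevSeminorm 0 φ) :=
    (Complex.abs_re_le_norm _).trans ((norm_inner_le_norm _ _).trans
      (mul_le_mul_of_nonneg_left (hLC φ) (norm_nonneg _)))
  rw [LinearMap.add_apply, map_add, inner_add_right, Complex.add_re, Module.End.mul_apply]
  linarith [neg_le_of_abs_le hrem]

lemma exists_norm_add_le (hq : IsBInfty q) (hL : L ∈ diffOps N) :
    ∃ C, 0 ≤ C ∧ ∀ φ, ‖toL2R ((mulOp q * momentumOp ^ N + L) φ)‖ ≤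
      C * (sobolevSeminorm N φ + sobolevSeminorm 0 φ) := by
  obtain ⟨B, hB, hqB⟩ := hq.exists_norm_le
  obtain ⟨C, hC, hLC⟩ := (relBoundZero_norm_of_mem_diffOps hL).exists_le
  refine ⟨1 + B + C, by positivity, fun φ => ?_⟩
  have hlead : ‖toL2R (mulOp q ((momentumOp ^ N) φ))‖ ≤ B * sobolevSeminorm N φ :=
    norm_mulOp_le hq hqB _
  calc _ ≤ B * sobolevSeminorm N φ + (sobolevSeminorm N φ + C * sobolevSeminorm 0 φ) := by
        rw [LinearMap.add_apply, map_add]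
        exact (norm_add_le _ _).trans (add_le_add hlead (hLC φ))
    _ ≤ _ := by
        nlinarith [sobolevSeminorm_nonneg N φ, sobolevSeminorm_nonneg 0 φ,
          mul_nonneg hC (sobolevSeminorm_nonneg N φ), mul_nonneg hB (sobolevSeminorm_nonneg 0 φ)]

lemma exists_isEllipticWith (hq : IsBInfty q) (hδ : 0 < δ) (hqδ : ∀ x, δ ≤ (q x).re)
    (hL : L ∈ diffOps (l + l)) :
    ∃ R c C : ℝ, 0 < c ∧ 0 ≤ C ∧ IsEllipticWith toL2R (toL2R ∘ₗ momentumOp ^ (l + l))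
      (toL2R ∘ₗ (mulOp q * momentumOp ^ (l + l) + L) + (R : ℂ) • toL2R) c C := by
  obtain ⟨C₁, hC₁, hgarding⟩ := garding_inequality hq hδ hqδ hL
  obtain ⟨C₂, hC₂, helliptic⟩ := exists_le_re_inner_add hq hδ hqδ hL
  obtain ⟨C₃, _, hnorm⟩ := exists_norm_add_le hq hL
  refine ⟨C₁ + δ / 2, δ / 2, max C₂ C₃ + (C₁ + δ / 2), half_pos hδ,
    add_nonneg (hC₂.trans (le_max_left C₂ C₃)) (by positivity),
    .add_smul_of_garding (half_pos hδ).le hC₁ (fun φ => (hgarding φ).trans' (by positivity))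
      (fun φ => (helliptic φ).trans ?_) fun φ => (hnorm φ).trans ?_⟩
  · exact add_le_add_right (mul_le_mul_of_nonneg_right (mul_le_mul_of_nonneg_right
      (le_max_left C₂ C₃) (norm_nonneg _)) (norm_nonneg _)) _
  · exact mul_le_mul_of_nonneg_right (le_max_right C₂ C₃)
      (add_nonneg (norm_nonneg _) (norm_nonneg _))

lemma exists_coercive_and_denseRange (hq : IsBInfty q) (hδ : 0 < δ) (hqδ : ∀ x, δ ≤ (q x).re)
    (hL : L ∈ diffOps (l + l)) :
    ∃ R c : ℝ, 0 < c ∧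
      (∀ φ, c * ‖toL2R φ‖ ^ 2 ≤ (inner ℂ (toL2R φ)
        (toL2R ((mulOp q * momentumOp ^ (l + l) + L) φ))).re + R * ‖toL2R φ‖ ^ 2) ∧
      DenseRange (toL2R ∘ₗ (mulOp q * momentumOp ^ (l + l) + L) + (R : ℂ) • toL2R) := by
  obtain ⟨R, c, C, hc, hC, hell⟩ := exists_isEllipticWith hq hδ hqδ hL
  refine ⟨R, c, hc, fun φ => (hell.coercive φ).trans_eq ?_, ?_⟩
  · rw [LinearMap.add_apply, LinearMap.smul_apply, inner_add_right, inner_smul_right,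
      Complex.add_re, Complex.re_ofReal_mul, re_inner_self_toL2R, LinearMap.comp_apply]
  · have href := (isEllipticWith_momentumOp_pow_add l).mono (min_le_right c 1) (le_max_right C _)
    exact (href.denseRange_iff (hell.mono (min_le_left c 1) (le_max_left C _))
      (lt_min hc one_pos) (hC.trans (le_max_left C _))).1 (denseRange_momentumOp_pow_add l)

lemma exists_abs_im_inner_le (hq : IsBInfty q) (hδ : 0 < δ) (hqδ : ∀ x, δ ≤ (q x).re)
    (hL : L ∈ diffOps (l + l)) :
    ∃ M C : ℝ, 0 ≤ M ∧ ∀ φ (w : ℂ),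
      w = inner ℂ (toL2R φ) (toL2R ((mulOp q * momentumOp ^ (l + l) + L) φ)) →
        0 ≤ w.re + C * ‖toL2R φ‖ ^ 2 ∧ |w.im| ≤ M * (w.re + C * ‖toL2R φ‖ ^ 2) := by
  obtain ⟨C₁, _, hgarding⟩ := garding_inequality hq hδ hqδ hL
  obtain ⟨C₂, hC₂, hbound⟩ := exists_norm_inner_le hq hL
  refine ⟨2 * C₂ / δ, C₁ + δ / 2, by positivity, ?_⟩
  rintro φ w rfl
  have hlow := hgarding φ
  have hup := (Complex.abs_im_le_norm _).trans (hbound φ)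
  rw [sobolevSeminorm_zero] at hlow hup
  set w : ℂ := inner ℂ (toL2R φ) (toL2R ((mulOp q * momentumOp ^ (l + l) + L) φ))
  have hre : δ / 2 * (sobolevSeminorm l φ ^ 2 + ‖toL2R φ‖ ^ 2) ≤
      w.re + (C₁ + δ / 2) * ‖toL2R φ‖ ^ 2 := by linarith
  refine ⟨hre.trans' (by positivity), hup.trans ?_⟩
  calc C₂ * (sobolevSeminorm l φ ^ 2 + ‖toL2R φ‖ ^ 2)
      = 2 * C₂ / δ * (δ / 2 * (sobolevSeminorm l φ ^ 2 + ‖toL2R φ‖ ^ 2)) := by field_simp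
    _ ≤ _ := by gcongr

end EllipticOperators

section GraphParametrization

variable {V H : Type*} [AddCommGroup V] [Module ℂ V] [NormedAddCommGroup H]
  [InnerProductSpace ℂ H] {T : H →ₗ.[ℂ] H} {J B : V →ₗ[ℂ] H}

lemma exists_domain_eq_of_graph_eq (hT : (T.graph : Set (H × H)) = Set.range fun v => (J v, B v))
    (v : V) : ∃ u : T.domain, (u : H) = J v ∧ T u = B v :=
  T.mem_graph_iff.1 (hT.superset (Set.mem_range_self v))

lemma exists_eq_of_graph_eq (hT : (T.graph : Set (H × H)) = Set.range fun v => (J v, B v))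
    (u : T.domain) : ∃ v, J v = u ∧ B v = T u := by
  obtain ⟨v, hv⟩ := hT.subset (T.mem_graph u)
  exact ⟨v, (Prod.mk.inj hv).1, (Prod.mk.inj hv).2⟩

lemma dense_domain_of_graph_eq (hT : (T.graph : Set (H × H)) = Set.range fun v => (J v, B v))
    (hJ : DenseRange J) : Dense (T.domain : Set H) := by
  refine hJ.mono ?_
  rintro _ ⟨v, rfl⟩
  obtain ⟨u, hu, -⟩ := exists_domain_eq_of_graph_eq hT v
  exact hu ▸ u.2

lemma exists_of_mem_numRange_of_graph_eq
    (hT : (T.graph : Set (H × H)) = Set.range fun v => (J v, B v)) {z : ℂ} (hz : z ∈ numRange T) :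
    ∃ v, ‖J v‖ = 1 ∧ z = inner ℂ (J v) (B v) := by
  obtain ⟨u, hu, rfl⟩ := hz
  obtain ⟨v, hJv, hBv⟩ := exists_eq_of_graph_eq hT u
  exact ⟨v, by rw [hJv, hu], by rw [hJv, hBv]⟩

lemma denseRange_subScalar_of_graph_eq
    (hT : (T.graph : Set (H × H)) = Set.range fun v => (J v, B v)) {μ : ℂ}
    (hdense : DenseRange (B - μ • J)) : DenseRange (subScalar T μ) := by
  refine hdense.mono ?_
  rintro _ ⟨v, rfl⟩
  obtain ⟨u, hu, hTu⟩ := exists_domain_eq_of_graph_eq hT v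
  exact ⟨u, by rw [subScalar_apply, hu, hTu]; rfl⟩

end GraphParametrization

section DiffOp

variable {N : ℕ} {q : ℕ → ℝ → ℂ}

/-- The differential operator `∑_{j ≤ N} q_j D ^ j` on the Schwartz space, where `D` is the
momentum operator. -/
def diffOp (N : ℕ) (q : ℕ → ℝ → ℂ) : Module.End ℂ 𝓢(ℝ, ℂ) :=
  ∑ j ∈ Finset.range (N + 1), mulOp (q j) * momentumOp ^ j

lemma diffOp_apply (hq : ∀ j ≤ N, IsBInfty (q j)) (φ : 𝓢(ℝ, ℂ)) :
    ⇑(diffOp N q φ) = diffExpr N q φ := by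
  funext x
  rw [diffOp, LinearMap.sum_apply, sum_apply, diffExpr]
  refine Finset.sum_congr rfl fun j hj => ?_
  rw [Module.End.mul_apply, mulOp_apply (hq j (Finset.mem_range_succ_iff.1 hj)),
    momentumOp_pow_apply]

lemma exists_smul_diffOp_eq (hq : ∀ j ≤ N, IsBInfty (q j)) (e : ℂ) :
    ∃ L ∈ diffOps N, e • diffOp N q = mulOp (fun x => e * q N x) * momentumOp ^ N + L := by
  refine ⟨e • ∑ j ∈ Finset.range N, mulOp (q j) * momentumOp ^ j,
    Submodule.smul_mem _ _ (Submodule.sum_mem _ fun j hj => ?_), ?_⟩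
  · have hjN := Finset.mem_range.1 hj
    exact mulOp_mul_mem_diffOps (hq j hjN.le) hjN
  · rw [diffOp, Finset.sum_range_succ, smul_add, mulOp_const_mul (hq N le_rfl), smul_mul_assoc,
      add_comm]

/-- `T` realises `∑_{j ≤ N} q_j D ^ j` in `L²(ℝ)` with the Schwartz functions as its domain. -/
def IsRealization (T : L2R →ₗ.[ℂ] L2R) (N : ℕ) (q : ℕ → ℝ → ℂ) : Prop :=
  (T.graph : Set (L2R × L2R)) = Set.range fun φ => (toL2R φ, (toL2R ∘ₗ diffOp N q) φ)

lemma isRealization_schurOp₀ (K : MatrixCoeffs) (hA : K.AssumptionA) (lam : ℂ)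
    (hd : lam ∉ closure (Set.range K.d)) (hB : ∀ j ≤ K.m, IsBInfty (K.schurCoeff lam j)) :
    IsRealization (schurOp₀ K hA lam hd) K.m (K.schurCoeff lam) := by
  have hop (φ : 𝓢(ℝ, ℂ)) :
      (toL2R (diffOp K.m (K.schurCoeff lam) φ) : ℝ → ℂ) =ᵐ[volume] K.schurExpr lam φ := by
    rw [schurExpr_eq_diffExpr hA hd (φ.smooth ⊤), ← diffOp_apply hB]
    exact coeFn_toL2R _
  ext p
  rw [SetLike.mem_coe, mem_graph_schurOp₀]
  constructor
  · rintro ⟨φ, hφ, hSφ⟩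
    exact ⟨φ, Prod.ext (Lp.ext ((coeFn_toL2R φ).trans hφ.symm))
      (Lp.ext ((hop φ).trans hSφ.symm))⟩
  · rintro ⟨φ, rfl⟩
    exact ⟨φ, coeFn_toL2R φ, hop φ⟩

end DiffOp

section StronglyElliptic

variable {N : ℕ} {q : ℕ → ℝ → ℂ} {T : L2R →ₗ.[ℂ] L2R} {θ δ : ℝ}

lemma exists_numRange_subset_closedSector (hN : Even N) (hq : ∀ j ≤ N, IsBInfty (q j))
    (hδ : 0 < δ) (hqδ : ∀ x, δ ≤ (Complex.exp (θ * Complex.I) * q N x).re)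
    (hT : IsRealization T N q) :
    ∃ (z₀ : ℂ) (ψ ϑ : ℝ), 0 ≤ ϑ ∧ ϑ < Real.pi / 2 ∧ numRange T ⊆ closedSector z₀ ψ ϑ := by
  obtain ⟨l, rfl⟩ := hN
  set e : ℂ := Complex.exp (θ * Complex.I)
  obtain ⟨L, hL, hP⟩ := exists_smul_diffOp_eq hq e
  obtain ⟨M, C, hM, hsector⟩ :=
    exists_abs_im_inner_le ((hq _ le_rfl).const_mul e) hδ hqδ hL
  refine ⟨-(C * Complex.exp (-(θ * Complex.I))), -θ, Real.arctan M, Real.arctan_nonneg.2 hM,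
    Real.arctan_lt_pi_div_two M, fun z hz => ?_⟩
  obtain ⟨φ, hφ, rfl⟩ := exists_of_mem_numRange_of_graph_eq hT hz
  have hφM := hsector φ (e * inner ℂ (toL2R φ) (toL2R (diffOp (l + l) q φ))) (by
    rw [← hP, LinearMap.smul_apply, map_smul, inner_smul_right])
  rw [hφ, one_pow, mul_one] at hφM
  exact mem_closedSector_of_abs_im_le hM hφM.1 hφM.2

lemma exists_notMem_closure_numRange_and_denseRange (hN : Even N)
    (hq : ∀ j ≤ N, IsBInfty (q j)) (hδ : 0 < δ)
    (hqδ : ∀ x, δ ≤ (Complex.exp (θ * Complex.I) * q N x).re) (hT : IsRealization T N q) :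
    ∃ μ, μ ∉ closure (numRange T) ∧ DenseRange (subScalar T μ) := by
  obtain ⟨l, rfl⟩ := hN
  set e : ℂ := Complex.exp (θ * Complex.I)
  have he : e ≠ 0 := Complex.exp_ne_zero _
  obtain ⟨L, hL, hP⟩ := exists_smul_diffOp_eq hq e
  obtain ⟨R, c, hc, hcoercive, hdense⟩ :=
    exists_coercive_and_denseRange ((hq _ le_rfl).const_mul e) hδ hqδ hL
  rw [← hP] at hdense
  simp only [← hP] at hcoercive
  refine ⟨-(e⁻¹ * R), fun hmem => ?_, denseRange_subScalar_of_graph_eq hT ?_⟩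
  · have hclosed : IsClosed {z : ℂ | c ≤ (e * z).re + R} :=
      isClosed_le continuous_const (by fun_prop)
    have hle : c ≤ (e * -(e⁻¹ * R)).re + R := closure_minimal (fun z hz => ?_) hclosed hmem
    · rw [mul_neg, mul_inv_cancel_left₀ he, Complex.neg_re, Complex.ofReal_re,
        neg_add_cancel] at hle
      exact hc.not_ge hle
    · obtain ⟨φ, hφ, rfl⟩ := exists_of_mem_numRange_of_graph_eq hT hz
      have hφc := hcoercive φ
      rwa [LinearMap.smul_apply, map_smul, inner_smul_right, hφ, one_pow, mul_one, mul_one] at hφc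
  · have hscale : toL2R ∘ₗ diffOp (l + l) q - (-(e⁻¹ * R)) • toL2R =
        e⁻¹ • (toL2R ∘ₗ (e • diffOp (l + l) q) + (R : ℂ) • toL2R) := by
      rw [LinearMap.comp_smul, smul_add, inv_smul_smul₀ he, smul_smul, neg_smul, sub_neg_eq_add]
    rw [hscale]
    exact (MulAction.surjective₀ (inv_ne_zero he)).denseRange.comp hdense
      (continuous_const_smul e⁻¹)

end StronglyElliptic

end

theorem mainTheorem8_general (K : MatrixCoeffs) (hm : Even K.m) (hA : K.AssumptionA) (lam : ℂ)
    (hd : lam ∉ closure (Set.range K.d)) (hB : ∀ j ≤ K.m, IsBInfty (K.schurCoeff lam j))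
    (hell : ∃ θ δ : ℝ, 0 < δ ∧
      ∀ x, δ ≤ (Complex.exp (θ * Complex.I) * K.schurCoeff lam K.m x).re) :
    (∃ (z₀ : ℂ) (ψ ϑ : ℝ), 0 ≤ ϑ ∧ ϑ < Real.pi / 2 ∧
      closure (numRange (schurOp K hA lam hd)) ⊆ closedSector z₀ ψ ϑ) ∧
    (closure (numRange (schurOp K hA lam hd)))ᶜ ⊆ resolventSetPMap (schurOp K hA lam hd) := by
  obtain ⟨θ, δ, hδ, hqδ⟩ := hell
  have hT := isRealization_schurOp₀ K hA lam hd hB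
  obtain ⟨z₀, ψ, ϑ, hϑ₀, hϑ, hsector⟩ := exists_numRange_subset_closedSector hm hB hδ hqδ hT
  obtain ⟨μ, hμ, hdense⟩ := exists_notMem_closure_numRange_and_denseRange hm hB hδ hqδ hT
  have hclosure := closure_numRange_closure_subset_and_compl_subset
    (dense_domain_of_graph_eq hT denseRange_toL2R) hϑ₀ hϑ hsector hμ hdense
  exact ⟨⟨z₀, ψ, ϑ, hϑ₀, hϑ, hclosure.1⟩, hclosure.2⟩

theorem mainTheorem8 (K : MatrixCoeffs) (hm : Even K.m) (hA : K.AssumptionA) (hC : K.AssumptionC)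
    (lam : ℂ) (hΔ : lam ∉ closure (Set.range K.Delta)) (hd : lam ∉ closure (Set.range K.d)) :
    (∃ (z₀ : ℂ) (ψ ϑ : ℝ), 0 ≤ ϑ ∧ ϑ < Real.pi / 2 ∧
      closure (numRange (schurOp K hA lam hd)) ⊆ closedSector z₀ ψ ϑ) ∧
    (closure (numRange (schurOp K hA lam hd)))ᶜ ⊆ resolventSetPMap (schurOp K hA lam hd) := by
  have hlam : lam ∉ closure (Set.range K.Delta) ∪ closure (Set.range K.d) := by
    rintro (h | h)
    exacts [hΔ h, hd h]
  exact mainTheorem8_general K hm hA lam hd (hC.schur_bounded lam hlam)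
    (hC.strongly_elliptic lam hlam)
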